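/- Let $I\subset\mathbb R$ be an interval and $t_0$ an interior point of $I$; all maps are $C^\infty$, and dots denote derivatives with respect to $t\in I$. Let $(\gamma,\nu):I\to\mathbb R^2\times S^1$ be a Legendre curve, i.e. $\gamma$ and $\nu$ are smooth, $|\nu|=1$ and $\dot\gamma(t)\cdot\nu(t)=0$ for all $t\in I$. Suppose $\nu(t)=(\cos\varphi(t),\sin\varphi(t))$ with a smooth function $\varphi:I\to\mathbb R$, put $\mu(t)=(-\sin\varphi(t),\cos\varphi(t))$ and $\beta(t)=\dot\gamma(t)\cdot\mu(t)$; thus the curvature $(\dot\nu\cdot\mu,\ \dot\gamma\cdot\mu)$ of the Legendre curve is $(\dot\varphi,\beta)$. For $(i,j)\in\{(2,3),(2,5),(3,4),(3,5)\}$ we say that $\gamma$ at $t_0$ is a $j/i$-cusp if its germ at $t_0$ is $\mathcal A$-equivalent to the germ of $t\mapsto(t^i,t^j)$ at $0$, i.e. there are germs of $C^\infty$ diffeomorphisms $\phi:(\mathbb R,t_0)\to(\mathbb R,0)$ and $\Phi:(\mathbb R^2,\gamma(t_0))\to(\mathbb R^2,0)$ such that $\Phi(\gamma(\phi^{-1}(s)))=(s^i,s^j)$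 for all $s$ near $0$. Theorem. Assume that $\beta(t_0)=0$. Then: (1) $\gamma$ at $t_0$ is a $3/2$-cusp if and only if $\dot\beta(t_0)\dot\varphi(t_0)\neq0$. (2) $\gamma$ at $t_0$ is a $5/2$-cusp if and only if $\dot\beta(t_0)\neq0$, $\dot\varphi(t_0)=0$ and $\ddot\beta(t_0)\ddot\varphi(t_0)-\dot\beta(t_0)\dddot\varphi(t_0)\neq0$. (3) $\gamma$ at $t_0$ is a $4/3$-cusp if and only if $\dot\beta(t_0)=0$ and $\ddot\beta(t_0)\dot\varphi(t_0)\neq0$. (4) $\gamma$ at $t_0$ is a $5/3$-cusp if and only if $\dot\beta(t_0)=\dot\varphi(t_0)=0$ and $\ddot\beta(t_0)\ddot\varphi(t_0)\neq0$. -/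

import Mathlib

open scoped ContDiff Topology

/-- The Euclidean plane. -/
abbrev Plane : Type := EuclideanSpace ℝ (Fin 2)

/-- The anticlockwise rotation of the plane by the angle `π / 2`. -/
def rotJ (v : Plane) : Plane := !₂[-(v 1), v 0]

/-- `(γ, ν) : I → ℝ² × S¹` is a Legendre curve on the interval `I`: both maps are smooth on `I`,
`ν` takes values in the unit circle, and `γ' · ν = 0` on `I`. -/
structure IsLegendreCurve (γ ν : ℝ → Plane) (I : Set ℝ) : Prop where
  smooth_curve : ContDiffOn ℝ ∞ γ I
  smooth_normal : ContDiffOn ℝ ∞ ν I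
  norm_normal : ∀ t ∈ I, ‖ν t‖ = 1
  tangency : ∀ t ∈ I, inner ℝ (derivWithin γ I t) (ν t) = 0

/-- The curvature `(ℓ, β)` of a Legendre curve `(γ, ν)` on `I`, where `ℓ = ν' · J ν` and
`β = γ' · J ν`. -/
noncomputable def legendreCurvature (γ ν : ℝ → Plane) (I : Set ℝ) (t : ℝ) : ℝ × ℝ :=
  (inner ℝ (derivWithin ν I t) (rotJ (ν t)), inner ℝ (derivWithin γ I t) (rotJ (ν t)))

/-- The local homeomorphism `e` represents a germ of a smooth diffeomorphism `(E, p) → (F, q)`. -/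
structure IsDiffeoGerm {E F : Type*} [NormedAddCommGroup E] [NormedSpace ℝ E]
    [NormedAddCommGroup F] [NormedSpace ℝ F]
    (e : OpenPartialHomeomorph E F) (p : E) (q : F) : Prop where
  mem_source : p ∈ e.source
  map_base : e p = q
  smooth : ContDiffOn ℝ ∞ e e.source
  smooth_symm : ContDiffOn ℝ ∞ e.symm e.target

/-- The germ of `f` at `p` is `𝒜`-equivalent to the germ of `g` at `q`: there are diffeomorphism
germs `φ : (E, p) → (E, q)` and `Φ : (F, f p) → (F, g q)` with `g = Φ ∘ f ∘ φ⁻¹` near `q`. -/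
def AEquivalentAt {E F : Type*} [NormedAddCommGroup E] [NormedSpace ℝ E]
    [NormedAddCommGroup F] [NormedSpace ℝ F] (f : E → F) (p : E) (g : E → F) (q : E) : Prop :=
  ∃ (φ : OpenPartialHomeomorph E E) (Φ : OpenPartialHomeomorph F F),
    IsDiffeoGerm φ p q ∧ IsDiffeoGerm Φ (f p) (g q) ∧
      ∀ᶠ s in 𝓝 q, g s = Φ (f (φ.symm s))

/-- `γ` at `t₀` is a `j/i`-cusp: its germ at `t₀` is `𝒜`-equivalent to the germ of
`t ↦ (t ^ i, t ^ j)` at the origin. -/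
def IsCuspAt (j i : ℕ) (γ : ℝ → Plane) (t₀ : ℝ) : Prop :=
  AEquivalentAt γ t₀ (fun t : ℝ => (!₂[t ^ i, t ^ j] : Plane)) 0

/-! Orthogonality of γ' and ν gives γ' = β μ. Put θ = φ(t₀) and φ = θ + u. In the frame turned by θ
the curve is (∫ β cos u, -∫ β sin u). If β and u are divisible by the powers n and m of t - t₀, with
nonzero leading value for β, a root of the first integral serves as parameter and the germ becomes
(tⁿ⁺¹, tⁿ⁺ᵐ⁺¹ k(t)) with computable k(0) and, for m ≥ 2, k'(0): this is
`exists_frontal_normal_form`. The pairs (n, m) = (1,1), (2,1), (2,2) belong to the 3/2-, 4/3- and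
5/3-cusp. For (1,2) the term k(0) t⁴ is a function of t² and can be sheared away, leaving (t², t⁵
r(t)) with r(0) = k'(0), which is 1/30 of the expression in the 5/2 criterion.

Sufficiency is finite determinacy: (tⁱ, tʲ k(t)) with k(0) ≠ 0 is equivalent to (tⁱ, tʲ). Terms with
exponents in the semigroup ⟨i, j⟩ are absorbed by a coordinate change of the plane. To do this for
smooth functions and not just power series, a function is split as Σ tˡ uₗ(tⁱ), using Borel's lemma
for the Taylor series and roots of flat functions for the remainder. For i = 3 the one gap of the
semigroup above j, namely 2j - 3, is removed by a change of parameter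
(`monomialCurve_three_equiv_gap`).

Necessity rests on two invariants: the multiplicity i (`not_aequivalentAt_of_isBigO`), and the first
exponent not divisible by i (`not_aequivalentAt_monomialCurve`). Together they make the cases of
`frontal_cusp_criteria` mutually exclusive. -/

/-! ### Weighted means, Hadamard quotients and Taylor's formula -/

/-- The weighted mean `∫₀¹ sⁿ g(ts) ds`. -/
noncomputable def moment (n : ℕ) (g : ℝ → ℝ) (t : ℝ) : ℝ :=
  ∫ s in (0 : ℝ)..1, s ^ n * g (t * s)

lemma ContDiff.deriv_infty {g : ℝ → ℝ} (hg : ContDiff ℝ ∞ g) : ContDiff ℝ ∞ (deriv g) :=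
  (contDiff_infty_iff_deriv.1 hg).2

lemma ContDiff.hasDerivAt_infty {g : ℝ → ℝ} (hg : ContDiff ℝ ∞ g) (t : ℝ) :
    HasDerivAt g (deriv g t) t :=
  ((contDiff_infty_iff_deriv.1 hg).1 t).hasDerivAt

/-- Differentiation under the integral sign produces one more factor s. Keeping the weight sⁿ
general makes the family of means closed under differentiation, so smoothness follows by induction.
-/
lemma hasDerivAt_moment (n : ℕ) {g : ℝ → ℝ} (hg : ContDiff ℝ ∞ g) (t : ℝ) :
    HasDerivAt (moment n g) (moment (n + 1) (deriv g) t) t := by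
  have hc := hg.continuous
  have hc' := hg.deriv_infty.continuous
  have hcont : Continuous fun p : ℝ × ℝ => p.2 ^ (n + 1) * deriv g (p.1 * p.2) := by fun_prop
  obtain ⟨C, hC⟩ := ((isCompact_closedBall t (1 : ℝ)).prod (isCompact_Icc (a := (0 : ℝ)) (b := 1)))
    |>.exists_bound_of_continuousOn hcont.continuousOn
  refine (intervalIntegral.hasDerivAt_integral_of_dominated_loc_of_deriv_le
    (F := fun x s => s ^ n * g (x * s)) (F' := fun x s => s ^ (n + 1) * deriv g (x * s))
    (bound := fun _ => C) (Metric.closedBall_mem_nhds t one_pos) ?_ ?_ ?_ ?_ ?_ ?_).2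
  · exact Filter.Eventually.of_forall fun x =>
      (by fun_prop : Continuous fun s : ℝ => s ^ n * g (x * s)).aestronglyMeasurable
  · exact (by fun_prop : Continuous fun s : ℝ => s ^ n * g (t * s)).intervalIntegrable _ _
  · exact (by fun_prop : Continuous fun s : ℝ =>
      s ^ (n + 1) * deriv g (t * s)).aestronglyMeasurable
  · refine Filter.Eventually.of_forall fun s hs x hx => hC (x, s) ⟨hx, ?_⟩
    rw [Set.uIoc_of_le zero_le_one] at hs
    exact ⟨hs.1.le, hs.2⟩
  · exact intervalIntegrable_const
  · refine Filter.Eventually.of_forall fun s _ x _ => ?_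
    have h := ((hg.hasDerivAt_infty (x * s)).comp x ((hasDerivAt_id x).mul_const s)).const_mul (s ^ n)
    refine h.congr_deriv ?_
    ring

lemma contDiff_moment (n : ℕ) {g : ℝ → ℝ} (hg : ContDiff ℝ ∞ g) : ContDiff ℝ ∞ (moment n g) := by
  rw [contDiff_infty]
  intro k
  induction k generalizing n g with
  | zero =>
    exact contDiff_zero.2 (continuous_iff_continuousAt.2 fun t =>
      (hasDerivAt_moment n hg t).continuousAt)
  | succ k ih =>
    have hd : deriv (moment n g) = moment (n + 1) (deriv g) :=
      funext fun t => (hasDerivAt_moment n hg t).deriv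
    push_cast
    rw [contDiff_succ_iff_deriv, hd]
    exact ⟨fun t => (hasDerivAt_moment n hg t).differentiableAt, by simp, ih _ hg.deriv_infty⟩

lemma moment_zero (n : ℕ) (g : ℝ → ℝ) : moment n g 0 = g 0 / (n + 1) := by
  simp [moment, div_eq_mul_inv, mul_comm]

lemma deriv_moment_zero (n : ℕ) {g : ℝ → ℝ} (hg : ContDiff ℝ ∞ g) :
    deriv (moment n g) 0 = deriv g 0 / (n + 2) := by
  rw [(hasDerivAt_moment n hg 0).deriv, moment_zero]
  push_cast
  ring

/-- Integrate the s-derivative of sⁿ⁺¹ g(ts) over [0, 1]. -/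
lemma moment_identity (n : ℕ) {g : ℝ → ℝ} (hg : ContDiff ℝ ∞ g) (t : ℝ) :
    (n + 1) * moment n g t + t * moment (n + 1) (deriv g) t = g t := by
  have hc := hg.continuous
  have hc' := hg.deriv_infty.continuous
  have h := intervalIntegral.integral_eq_sub_of_hasDerivAt (a := 0) (b := 1)
    (f := fun s => s ^ (n + 1) * g (t * s))
    (f' := fun s => (n + 1) * (s ^ n * g (t * s)) + t * (s ^ (n + 1) * deriv g (t * s)))
    (fun s _ => by
      have h := (hasDerivAt_pow (n + 1) s).mul
        ((hg.hasDerivAt_infty (t * s)).comp s ((hasDerivAt_id s).const_mul t))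
      refine h.congr_deriv ?_
      simp only [Function.comp_apply]
      push_cast
      ring)
    ((by fun_prop : Continuous fun s : ℝ => ((n : ℝ) + 1) * (s ^ n * g (t * s))
      + t * (s ^ (n + 1) * deriv g (t * s))).intervalIntegrable _ _)
  rw [intervalIntegral.integral_add, intervalIntegral.integral_const_mul,
    intervalIntegral.integral_const_mul] at h
  · simpa [moment] using h
  · exact Continuous.intervalIntegrable (by fun_prop) _ _
  · exact Continuous.intervalIntegrable (by fun_prop) _ _

/-- This supplies the primitive of tⁿ g(t) vanishing at 0 with its factor tⁿ⁺¹ already split off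
smoothly. -/
lemma hasDerivAt_pow_mul_moment (n : ℕ) {g : ℝ → ℝ} (hg : ContDiff ℝ ∞ g) (t : ℝ) :
    HasDerivAt (fun t => t ^ (n + 1) * moment n g t) (t ^ n * g t) t := by
  refine ((hasDerivAt_pow (n + 1) t).mul (hasDerivAt_moment n hg t)).congr_deriv ?_
  rw [← moment_identity n hg t]
  push_cast
  ring

/-- Hadamard's lemma. -/
lemma eq_add_mul_moment {f : ℝ → ℝ} (hf : ContDiff ℝ ∞ f) (t : ℝ) :
    f t = f 0 + t * moment 0 (deriv f) t := by
  have h := intervalIntegral.integral_eq_sub_of_hasDerivAt (a := 0) (b := 1)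
    (f := fun s => f (t * s)) (f' := fun s => t * deriv f (t * s))
    (fun s _ => by
      have h := (hf.hasDerivAt_infty (t * s)).comp s ((hasDerivAt_id s).const_mul t)
      refine h.congr_deriv ?_
      simp only [mul_one]
      ring)
    (Continuous.intervalIntegrable (by have := hf.deriv_infty.continuous; fun_prop) _ _)
  rw [intervalIntegral.integral_const_mul] at h
  simp only [moment, pow_zero, one_mul]
  rw [h]
  simp

lemma exists_eq_add_mul {f : ℝ → ℝ} (hf : ContDiff ℝ ∞ f) :
    ∃ r : ℝ → ℝ, ContDiff ℝ ∞ r ∧ ∀ t, f t = f 0 + t * r t :=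
  ⟨_, contDiff_moment 0 hf.deriv_infty, eq_add_mul_moment hf⟩

lemma iteratedDeriv_moment (k n : ℕ) {g : ℝ → ℝ} (hg : ContDiff ℝ ∞ g) :
    iteratedDeriv k (moment n g) = moment (n + k) (iteratedDeriv k g) := by
  induction k generalizing n g with
  | zero => simp
  | succ k ih =>
    rw [iteratedDeriv_succ', iteratedDeriv_succ',
      show deriv (moment n g) = moment (n + 1) (deriv g) from
        funext fun t => (hasDerivAt_moment n hg t).deriv, ih _ hg.deriv_infty]
    congr 1
    ring

/-- Taylor's formula with smooth remainder. -/
lemma exists_taylor {f : ℝ → ℝ} (hf : ContDiff ℝ ∞ f) (n : ℕ) :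
    ∃ r : ℝ → ℝ, ContDiff ℝ ∞ r ∧ ∀ t, f t =
      ∑ m ∈ Finset.range n, iteratedDeriv m f 0 / (m.factorial : ℝ) * t ^ m + t ^ n * r t := by
  induction n generalizing f with
  | zero => exact ⟨f, hf, by simp⟩
  | succ n ih =>
    obtain ⟨r, hr, h⟩ := ih (contDiff_moment 0 hf.deriv_infty)
    refine ⟨r, hr, fun t => ?_⟩
    rw [eq_add_mul_moment hf t, h t, Finset.sum_range_succ']
    simp only [iteratedDeriv_moment _ _ hf.deriv_infty, moment_zero, ← iteratedDeriv_succ',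
      Nat.factorial_succ, mul_add, Finset.mul_sum]
    simp only [iteratedDeriv_zero, pow_zero, Nat.factorial_zero, Nat.cast_one]
    have : ∀ m ∈ Finset.range n, t * (iteratedDeriv (m + 1) f 0 / (((0 + m : ℕ) : ℝ) + 1)
        / (m.factorial : ℝ) * t ^ m) =
        iteratedDeriv (m + 1) f 0 / (((m + 1) * m.factorial : ℕ) : ℝ) * t ^ (m + 1) := by
      intro m _
      have := m.factorial_pos
      have h1 : (m.factorial : ℝ) ≠ 0 := by positivity
      push_cast
      rw [zero_add]
      field_simp
      ring
    rw [Finset.sum_congr rfl this]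
    ring

/-! ### Prescribing Taylor series -/

/-- **Borel's lemma**. -/
theorem exists_contDiff_iteratedDeriv_eq (c : ℕ → ℝ) :
    ∃ u : ℝ → ℝ, ContDiff ℝ ∞ u ∧ ∀ n, iteratedDeriv n u 0 = c n := by
  let χ : ContDiffBump (0 : ℝ) := ⟨1, 2, one_pos, one_lt_two⟩
  let g : ℕ → ℝ → ℝ := fun n x => x ^ n * χ x
  have hg : ∀ n, ContDiff ℝ ∞ (g n) := fun n => (contDiff_id.pow n).mul χ.contDiff
  have hgs : ∀ n, HasCompactSupport (g n) := fun n => χ.hasCompactSupport.mul_left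
  have hbound : ∀ n k, ∃ C : ℝ, ∀ x, ‖iteratedDeriv k (g n) x‖ ≤ C := by
    intro n k
    obtain ⟨C, hC⟩ := ((hgs n).iteratedFDeriv (𝕜 := ℝ) k).exists_bound_of_continuous
      ((hg n).continuous_iteratedFDeriv (by exact_mod_cast le_top))
    exact ⟨C, fun x => by simpa only [norm_iteratedFDeriv_eq_norm_iteratedDeriv] using hC x⟩
  choose C hC using hbound
  have hC0 : ∀ n k, 0 ≤ C n k := fun n k => (norm_nonneg _).trans (hC n k 0)
  -- The n-th term will be a cut-off monomial shrunk by the factor `l n`. Its k-th derivative scales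
  -- by (l n)ᵏ⁻ⁿ, which for k < n is at most 1 / l n because `l n ≥ 1`; the second summand makes the
  -- resulting bound at most 2⁻ⁿ.
  let l : ℕ → ℝ := fun n => 1 + 2 ^ n * |c n| * ∑ k ∈ Finset.range n, C n k
  have hl : ∀ n, 1 ≤ l n := fun n => by
    have : 0 ≤ 2 ^ n * |c n| * ∑ k ∈ Finset.range n, C n k :=
      mul_nonneg (by positivity) (Finset.sum_nonneg fun k _ => hC0 n k)
    simp only [l]
    linarith
  let f : ℕ → ℝ → ℝ := fun n x => c n / n.factorial / l n ^ n * g n (l n * x)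
  have hf : ∀ n, ContDiff ℝ ∞ (f n) := fun n =>
    contDiff_const.mul ((hg n).comp (contDiff_const.mul contDiff_id))
  have hfd : ∀ n k x, iteratedDeriv k (f n) x =
      c n / n.factorial / l n ^ n * (l n ^ k * iteratedDeriv k (g n) (l n * x)) := by
    intro n k x
    simp only [f]
    rw [iteratedDeriv_const_mul_field,
      iteratedDeriv_comp_const_mul ((hg n).of_le (by exact_mod_cast le_top))]
  -- For fixed k the geometric bound can fail only for the finitely many n ≤ k, and these get their
  -- own crude bound; summability is unaffected.
  let v : ℕ → ℕ → ℝ := fun k n => (1 / 2) ^ n +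
    if n ≤ k then |c n / n.factorial / l n ^ n| * (l n ^ k * C n k) else 0
  have hv : ∀ k, Summable (v k) := fun k =>
    summable_geometric_two.add (summable_of_hasFiniteSupport
      ((Set.finite_Iic k).subset fun n hn => by
        by_contra h
        exact hn (if_neg h)))
  have hfv : ∀ k n x, ‖iteratedFDeriv ℝ k (f n) x‖ ≤ v k n := by
    intro k n x
    have hln : 0 < l n := one_pos.trans_le (hl n)
    rw [norm_iteratedFDeriv_eq_norm_iteratedDeriv, hfd, norm_mul, norm_mul, Real.norm_eq_abs,
      Real.norm_eq_abs (l n ^ k), abs_of_pos (pow_pos hln k)]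
    have h1 : |c n / n.factorial / l n ^ n| * (l n ^ k * ‖iteratedDeriv k (g n) (l n * x)‖) ≤
        |c n / n.factorial / l n ^ n| * (l n ^ k * C n k) := by
      gcongr
      exact hC n k _
    refine h1.trans ?_
    simp only [v]
    split_ifs with h
    · simp
    · rw [not_le] at h
      have hfac : (1 : ℝ) ≤ n.factorial := by exact_mod_cast n.factorial_pos
      have hpow : l n ^ k * l n ≤ l n ^ n := by
        rw [← pow_succ]
        exact pow_le_pow_right₀ (hl n) h
      have hsum : C n k ≤ ∑ k ∈ Finset.range n, C n k :=
        Finset.single_le_sum (f := C n) (fun k _ => hC0 n k) (Finset.mem_range.2 h)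
      have h2 : |c n| * C n k ≤ (1 / 2) ^ n * l n := by
        have h3 : |c n| * C n k ≤ |c n| * ∑ k ∈ Finset.range n, C n k := by gcongr
        have h4 : ((1 : ℝ) / 2) ^ n * l n = (1 / 2) ^ n +
            |c n| * ∑ k ∈ Finset.range n, C n k := by
          simp only [l, mul_add, mul_one, one_div, inv_pow]
          field_simp
        rw [h4]
        have : (0 : ℝ) ≤ (1 / 2) ^ n := by positivity
        linarith
      rw [abs_div, abs_div, abs_of_pos (pow_pos hln n), Nat.abs_cast, add_zero,
        div_div, div_mul_eq_mul_div, div_le_iff₀ (by positivity)]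
      calc |c n| * (l n ^ k * C n k) = l n ^ k * (|c n| * C n k) := by ring
        _ ≤ l n ^ k * ((1 / 2) ^ n * l n) := by gcongr
        _ = (1 / 2) ^ n * (l n ^ k * l n) := by ring
        _ ≤ (1 / 2) ^ n * l n ^ n := by gcongr
        _ ≤ (1 / 2) ^ n * (n.factorial * l n ^ n) := by
          gcongr
          exact le_mul_of_one_le_left (by positivity) hfac
  refine ⟨fun x => ∑' n, f n x, contDiff_tsum (N := ⊤) hf (fun k _ => hv k)
    (fun k n x _ => hfv k n x), fun k => ?_⟩
  have hd0 : ∀ n, iteratedDeriv k (f n) 0 = if n = k then c k else 0 := by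
    intro n
    have hg0 : g n =ᶠ[𝓝 0] fun x => x ^ n := by
      filter_upwards [χ.eventuallyEq_one] with x hx
      simp [g, hx]
    have hln : 0 < l n := one_pos.trans_le (hl n)
    rw [hfd, mul_zero, hg0.iteratedDeriv_eq, iteratedDeriv_fun_pow_zero]
    by_cases h : k = n
    · subst h
      have hfac : (k.factorial : ℝ) ≠ 0 := by exact_mod_cast k.factorial_ne_zero
      simp only [if_true]
      field_simp
    · simp [h, Ne.symm h]
  have hs : Summable fun n => iteratedFDeriv ℝ k (f n) 0 :=
    .of_norm_bounded (hv k) fun n => hfv k n 0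
  rw [iteratedDeriv_eq_iteratedFDeriv, iteratedFDeriv_tsum_apply (N := ⊤) hf (fun k _ => hv k)
    (fun k n x _ => hfv k n x) le_top, ContinuousMultilinearMap.tsum_eval hs]
  simp only [← iteratedDeriv_eq_iteratedFDeriv, hd0]
  simp

/-! ### Flat functions and substitution of roots -/

/-- The smooth function `f` vanishes to infinite order at the origin. -/
def IsFlat (f : ℝ → ℝ) : Prop :=
  ∀ n : ℕ, ∃ r : ℝ → ℝ, ContDiff ℝ ∞ r ∧ ∀ t, f t = t ^ n * r t

lemma IsFlat.contDiff {f : ℝ → ℝ} (hf : IsFlat f) : ContDiff ℝ ∞ f := by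
  obtain ⟨r, hr, h⟩ := hf 0
  rw [show f = r from funext fun t => by simp [h t]]
  exact hr

lemma IsFlat.comp_neg {f : ℝ → ℝ} (hf : IsFlat f) : IsFlat fun t => f (-t) := by
  intro n
  obtain ⟨r, hr, h⟩ := hf n
  refine ⟨fun t => (-1) ^ n * r (-t), contDiff_const.mul (hr.comp contDiff_neg), fun t => ?_⟩
  change f (-t) = _
  rw [h (-t), neg_pow]
  ring

lemma IsFlat.add {f g : ℝ → ℝ} (hf : IsFlat f) (hg : IsFlat g) : IsFlat fun t => f t + g t := by
  intro n
  obtain ⟨r, hr, h⟩ := hf n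
  obtain ⟨s, hs, h'⟩ := hg n
  exact ⟨_, hr.add hs, fun t => by simp only [h, h', mul_add]⟩

lemma IsFlat.mul_left {f g : ℝ → ℝ} (hf : IsFlat f) (hg : ContDiff ℝ ∞ g) :
    IsFlat fun t => g t * f t := by
  intro n
  obtain ⟨r, hr, h⟩ := hf n
  exact ⟨_, hg.mul hr, fun t => by simp only [h]; ring⟩

lemma IsFlat.deriv_flat {f : ℝ → ℝ} (hf : IsFlat f) : IsFlat (deriv f) := by
  intro n
  obtain ⟨r, hr, h⟩ := hf (n + 1)
  refine ⟨fun t => (n + 1) * r t + t * deriv r t,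
    (contDiff_const.mul hr).add (contDiff_id.mul hr.deriv_infty), fun t => ?_⟩
  have hd : HasDerivAt f _ t := ((hasDerivAt_pow (n + 1) t).mul
    (hr.hasDerivAt_infty t)).congr_of_eventuallyEq (Filter.Eventually.of_forall h)
  rw [hd.deriv]
  push_cast
  ring

lemma Continuous.eq_of_pow_mul_eq {f g : ℝ → ℝ} (hf : Continuous f) (hg : Continuous g) (n : ℕ)
    (h : ∀ t, t ^ n * f t = t ^ n * g t) : f = g := by
  refine Continuous.ext_on (dense_compl_singleton (0 : ℝ)) hf hg fun t ht => ?_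
  exact mul_left_cancel₀ (pow_ne_zero n ht) (h t)

lemma IsFlat.exists_eq_pow_mul {f : ℝ → ℝ} (hf : IsFlat f) (m : ℕ) :
    ∃ g, IsFlat g ∧ ∀ t, f t = t ^ m * g t := by
  obtain ⟨g, hg, h⟩ := hf m
  refine ⟨g, fun n => ?_, h⟩
  obtain ⟨r, hr, h'⟩ := hf (m + n)
  have := Continuous.eq_of_pow_mul_eq hg.continuous
    ((contDiff_id.pow n).mul hr).continuous m fun t => by
      rw [← h, h', pow_add, id, mul_assoc]
  exact ⟨r, hr, fun t => by rw [this]; rfl⟩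

/-- The function `s ↦ f (s ^ (1 / k))` on the positive half-line, extended by zero. -/
noncomputable def rootComp (k : ℕ) (f : ℝ → ℝ) (s : ℝ) : ℝ :=
  if 0 < s then f (s ^ (1 / k : ℝ)) else 0

/-- With t = s^(1/k) the chain rule gives f'(t) / (k tᵏ⁻¹). Flatness of f' absorbs the negative
power, so the derivative is again `rootComp` of a flat function and the argument can be iterated. -/
lemma IsFlat.hasDerivAt_rootComp {k : ℕ} (hk : k ≠ 0) {f : ℝ → ℝ} (hf : IsFlat f) :
    ∃ g, IsFlat g ∧ ∀ s, HasDerivAt (rootComp k f) (rootComp k g s) s := by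
  obtain ⟨g₀, hg₀, h⟩ := hf.deriv_flat.exists_eq_pow_mul (k - 1)
  refine ⟨_, hg₀.mul_left (contDiff_const (c := (1 / k : ℝ))), fun s => ?_⟩
  have hk0 : (k : ℝ) ≠ 0 := by exact_mod_cast hk
  rcases lt_trichotomy s 0 with hs | rfl | hs
  · have he : rootComp k f =ᶠ[𝓝 s] fun _ => 0 := by
      filter_upwards [eventually_lt_nhds hs] with x hx
      exact if_neg hx.le.not_gt
    rw [rootComp, if_neg hs.le.not_gt]
    exact (hasDerivAt_const s (0 : ℝ)).congr_of_eventuallyEq he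
  -- Vanishing to order 2k in t is vanishing to order 2 in s = tᵏ, enough for derivative 0 at the
  -- origin.
  · obtain ⟨r, hr, h'⟩ := hf (2 * k)
    rw [rootComp, if_neg (lt_irrefl _)]
    obtain ⟨C, hC⟩ := (isCompact_Icc (a := (0 : ℝ)) (b := 1)).exists_bound_of_continuousOn
      hr.continuous.continuousOn
    have hC0 : 0 ≤ C := (norm_nonneg _).trans (hC 0 ⟨le_rfl, zero_le_one⟩)
    rw [hasDerivAt_iff_isLittleO]
    have hO : rootComp k f =O[𝓝 0] fun s : ℝ => s ^ 2 := by
      refine Asymptotics.IsBigO.of_bound C ?_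
      filter_upwards [eventually_lt_nhds (zero_lt_one (α := ℝ))] with s hs1
      unfold rootComp
      split_ifs with hs
      · have hp : (s ^ (1 / k : ℝ)) ^ (2 * k) = s ^ 2 := by
          rw [← Real.rpow_natCast, ← Real.rpow_mul hs.le, ← Real.rpow_natCast]
          congr 1
          push_cast
          field_simp
        rw [h', hp, norm_mul, mul_comm]
        gcongr
        exact hC _ ⟨Real.rpow_nonneg hs.le _, Real.rpow_le_one hs.le hs1.le (by positivity)⟩
      · rw [norm_zero]
        positivity
    have ho : (fun s : ℝ => s ^ 2) =o[𝓝 0] fun s : ℝ => s := by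
      simpa using Asymptotics.isLittleO_pow_pow (𝕜 := ℝ) one_lt_two
    have h0 : rootComp k f 0 = 0 := if_neg (lt_irrefl _)
    simpa [h0] using hO.trans_isLittleO ho
  · have he : rootComp k f =ᶠ[𝓝 s] fun x => f (x ^ (1 / k : ℝ)) := by
      filter_upwards [eventually_gt_nhds hs] with x hx
      exact if_pos hx
    refine HasDerivAt.congr_of_eventuallyEq ?_ he
    have hd := (hf.contDiff.hasDerivAt_infty _).comp s
      (Real.hasDerivAt_rpow_const (p := (1 / k : ℝ)) (Or.inl hs.ne'))
    refine hd.congr_deriv ?_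
    have hp : (s ^ (1 / k : ℝ)) ^ (k - 1) * s ^ (1 / k - 1 : ℝ) = 1 := by
      rw [← Real.rpow_natCast, ← Real.rpow_mul hs.le, ← Real.rpow_add hs,
        Nat.cast_sub (Nat.one_le_iff_ne_zero.2 hk)]
      have : 1 / (k : ℝ) * ((k : ℝ) - (1 : ℕ)) + (1 / k - 1) = 0 := by
        push_cast
        field_simp
        ring
      rw [this, Real.rpow_zero]
    rw [rootComp, if_pos hs, h]
    linear_combination (1 / k : ℝ) * g₀ (s ^ (1 / k : ℝ)) * hp

lemma IsFlat.contDiff_rootComp {k : ℕ} (hk : k ≠ 0) {f : ℝ → ℝ} (hf : IsFlat f) :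
    ContDiff ℝ ∞ (rootComp k f) := by
  rw [contDiff_infty]
  intro n
  induction n generalizing f with
  | zero =>
    obtain ⟨g, -, h⟩ := hf.hasDerivAt_rootComp hk
    exact contDiff_zero.2 (continuous_iff_continuousAt.2 fun t => (h t).continuousAt)
  | succ n ih =>
    obtain ⟨g, hg, h⟩ := hf.hasDerivAt_rootComp hk
    push_cast
    rw [contDiff_succ_iff_deriv, show deriv (rootComp k f) = rootComp k g from
      funext fun t => (h t).deriv]
    exact ⟨fun t => (h t).differentiableAt, by simp, ih hg⟩

lemma IsFlat.apply_zero {f : ℝ → ℝ} (hf : IsFlat f) : f 0 = 0 := by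
  obtain ⟨r, -, h⟩ := hf 1
  simp [h 0]

lemma rootComp_pow {k : ℕ} (hk : k ≠ 0) (f : ℝ → ℝ) {t : ℝ} (ht : 0 < t) :
    rootComp k f (t ^ k) = f t := by
  rw [rootComp, if_pos (pow_pos ht k), one_div, Real.pow_rpow_inv_natCast ht.le hk]

lemma IsFlat.exists_comp_sq {f : ℝ → ℝ} (hf : IsFlat f) (he : ∀ t, f (-t) = f t) :
    ∃ g : ℝ → ℝ, ContDiff ℝ ∞ g ∧ ∀ t, f t = g (t ^ 2) := by
  refine ⟨_, hf.contDiff_rootComp two_ne_zero, fun t => ?_⟩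
  rcases lt_trichotomy t 0 with ht | rfl | ht
  · rw [← neg_sq, rootComp_pow two_ne_zero _ (neg_pos.2 ht), he]
  · simp [rootComp, hf.apply_zero]
  · rw [rootComp_pow two_ne_zero _ ht]

/-- The cube is a bijection of the line, so no symmetry is needed: the two half-lines are treated
separately, and each summand vanishes on the other one. -/
lemma IsFlat.exists_comp_cube {f : ℝ → ℝ} (hf : IsFlat f) :
    ∃ g : ℝ → ℝ, ContDiff ℝ ∞ g ∧ ∀ t, f t = g (t ^ 3) := by
  refine ⟨_, (hf.contDiff_rootComp three_ne_zero).add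
    ((hf.comp_neg.contDiff_rootComp three_ne_zero).comp contDiff_neg), fun t => ?_⟩
  have h3 : -t ^ 3 = (-t) ^ 3 := by ring
  rcases lt_trichotomy t 0 with ht | rfl | ht
  · have : t ^ 3 < 0 := Odd.pow_neg (by decide) ht
    simp only [Function.comp_apply]
    rw [h3, rootComp_pow three_ne_zero _ (neg_pos.2 ht), rootComp, if_neg this.le.not_gt]
    simp
  · simp [rootComp, hf.apply_zero]
  · have : -t ^ 3 ≤ 0 := by have := pow_pos ht 3; linarith
    simp only [Function.comp_apply]
    rw [rootComp_pow three_ne_zero _ ht, rootComp, if_neg this.not_gt]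
    simp

/-! ### Splitting smooth functions by residues of exponents -/

lemma sum_range_mul_eq (i n : ℕ) (a : ℕ → ℝ) :
    ∑ m ∈ Finset.range (i * n), a m =
      ∑ l ∈ Finset.range i, ∑ m ∈ Finset.range n, a (i * m + l) := by
  induction n with
  | zero => simp
  | succ n ih =>
    rw [Nat.mul_succ, Finset.sum_range_add, ih, ← Finset.sum_add_distrib]
    exact Finset.sum_congr rfl fun l _ => (Finset.sum_range_succ _ _).symm

/-- Splitting a smooth function by the residues of its exponents, up to a flat function. -/
lemma exists_flat_decomposition {i : ℕ} (hi : i ≠ 0) {f : ℝ → ℝ} (hf : ContDiff ℝ ∞ f) :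
    ∃ u : ℕ → ℝ → ℝ, (∀ l, ContDiff ℝ ∞ (u l)) ∧
      IsFlat fun t => f t - ∑ l ∈ Finset.range i, t ^ l * u l (t ^ i) := by
  -- Borel's lemma realises the Taylor coefficients of f at exponents congruent to l modulo i as the
  -- Taylor series of one smooth function `u l`.
  have hB := fun l : ℕ => exists_contDiff_iteratedDeriv_eq
    fun m => iteratedDeriv (i * m + l) f 0 / (i * m + l).factorial * m.factorial
  choose u hu hu' using hB
  refine ⟨u, hu, fun n => ?_⟩
  obtain ⟨R, hR, hfR⟩ := exists_taylor hf (i * n)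
  have hr := fun l => exists_taylor (hu l) n
  choose r hr hur using hr
  obtain ⟨p, hp⟩ : ∃ p, i * n = n + p := ⟨i * n - n, by
    have := Nat.le_mul_of_pos_left n (Nat.pos_of_ne_zero hi)
    omega⟩
  refine ⟨fun t => t ^ p * (R t - ∑ l ∈ Finset.range i, t ^ l * r l (t ^ i)),
    (contDiff_id.pow p).mul (hR.sub (ContDiff.sum fun l _ => (contDiff_id.pow l).mul
      ((hr l).comp (contDiff_id.pow i)))), fun t => ?_⟩
  have h : ∀ l, t ^ l * u l (t ^ i) = ∑ m ∈ Finset.range n,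
      iteratedDeriv (i * m + l) f 0 / (i * m + l).factorial * t ^ (i * m + l) +
      t ^ (i * n) * (t ^ l * r l (t ^ i)) := by
    intro l
    rw [hur l, mul_add, Finset.mul_sum]
    congr 1
    · refine Finset.sum_congr rfl fun m _ => ?_
      have : (m.factorial : ℝ) ≠ 0 := by exact_mod_cast m.factorial_ne_zero
      rw [hu', mul_div_cancel_right₀ _ this, ← pow_mul, pow_add]
      ring
    · rw [← pow_mul]
      ring
  simp only [h, Finset.sum_add_distrib, ← Finset.mul_sum]
  rw [hfR t, sum_range_mul_eq, ← mul_assoc, ← pow_add, ← hp]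
  ring

lemma exists_cubic_decomposition {f : ℝ → ℝ} (hf : ContDiff ℝ ∞ f) :
    ∃ a b c : ℝ → ℝ, ContDiff ℝ ∞ a ∧ ContDiff ℝ ∞ b ∧ ContDiff ℝ ∞ c ∧
      ∀ t, f t = a (t ^ 3) + t * b (t ^ 3) + t ^ 2 * c (t ^ 3) := by
  obtain ⟨u, hu, hflat⟩ := exists_flat_decomposition three_ne_zero hf
  obtain ⟨g, hg, h⟩ := hflat.exists_comp_cube
  refine ⟨_, _, _, (hu 0).add hg, hu 1, hu 2, fun t => ?_⟩
  have := h t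
  simp only [Finset.sum_range_succ, Finset.sum_range_zero] at this
  linear_combination this

lemma exists_quadratic_decomposition {f : ℝ → ℝ} (hf : ContDiff ℝ ∞ f) :
    ∃ a b : ℝ → ℝ, ContDiff ℝ ∞ a ∧ ContDiff ℝ ∞ b ∧
      ∀ t, f t = a (t ^ 2) + t * b (t ^ 2) := by
  obtain ⟨u, hu, hflat⟩ := exists_flat_decomposition two_ne_zero hf
  set F := fun t => f t - ∑ l ∈ Finset.range 2, t ^ l * u l (t ^ 2) with hF
  -- The flat remainder need not be a function of t². Its even part is one, and its odd part is t
  -- times an even flat function.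
  have hE : IsFlat fun t => 1 / 2 * (F t + F (-t)) :=
    (hflat.add hflat.comp_neg).mul_left contDiff_const
  have hO : IsFlat fun t => 1 / 2 * (F t + -1 * F (-t)) :=
    (hflat.add (hflat.comp_neg.mul_left contDiff_const)).mul_left contDiff_const
  obtain ⟨G, hGf, hG⟩ := hO.exists_eq_pow_mul 1
  have hGe : (fun t => G (-t)) = G := by
    refine Continuous.eq_of_pow_mul_eq (hGf.contDiff.comp contDiff_neg).continuous
      hGf.contDiff.continuous 1 fun t => ?_
    have h1 := hG t
    have h2 := hG (-t)
    rw [neg_neg] at h2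
    linear_combination h1 + h2
  obtain ⟨g, hg, h⟩ := hE.exists_comp_sq fun t => by
    simp only [neg_neg]
    ring
  obtain ⟨k, hk, h'⟩ := hGf.exists_comp_sq fun t => congrFun hGe t
  refine ⟨_, _, (hu 0).add hg, (hu 1).add hk, fun t => ?_⟩
  have h1 := h t
  have h2 := hG t
  rw [h'] at h2
  have h3 : F t = f t - ∑ l ∈ Finset.range 2, t ^ l * u l (t ^ 2) := rfl
  simp only [Finset.sum_range_succ, Finset.sum_range_zero] at h3
  linear_combination h1 + h2 - h3

/-! ### Diffeomorphism germs and 𝒜-equivalence -/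

section Germs

variable {E F G : Type*} [NormedAddCommGroup E] [NormedSpace ℝ E]
  [NormedAddCommGroup F] [NormedSpace ℝ F] [NormedAddCommGroup G] [NormedSpace ℝ G]

lemma IsDiffeoGerm.symm {e : OpenPartialHomeomorph E F} {p : E} {q : F}
    (h : IsDiffeoGerm e p q) : IsDiffeoGerm e.symm q p where
  mem_source := h.map_base ▸ e.map_source h.mem_source
  map_base := h.map_base ▸ e.left_inv h.mem_source
  smooth := h.smooth_symm
  smooth_symm := h.smooth

lemma IsDiffeoGerm.trans {e : OpenPartialHomeomorph E F} {e' : OpenPartialHomeomorph F G}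
    {p : E} {q : F} {r : G} (h : IsDiffeoGerm e p q) (h' : IsDiffeoGerm e' q r) :
    IsDiffeoGerm (e.trans e') p r where
  mem_source := by
    rw [OpenPartialHomeomorph.trans_source]
    exact ⟨h.mem_source, by rw [Set.mem_preimage, h.map_base]; exact h'.mem_source⟩
  map_base := by simp [h.map_base, h'.map_base]
  smooth := by
    rw [OpenPartialHomeomorph.coe_trans, OpenPartialHomeomorph.trans_source]
    exact h'.smooth.comp (h.smooth.mono Set.inter_subset_left) fun x hx => hx.2
  smooth_symm := by
    rw [OpenPartialHomeomorph.coe_trans_symm, OpenPartialHomeomorph.trans_target]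
    exact h.smooth_symm.comp (h'.smooth_symm.mono Set.inter_subset_left) fun x hx => hx.2

lemma IsDiffeoGerm.continuousAt {e : OpenPartialHomeomorph E F} {p : E} {q : F}
    (h : IsDiffeoGerm e p q) : ContinuousAt e p := e.continuousAt h.mem_source

lemma IsDiffeoGerm.contDiffAt {e : OpenPartialHomeomorph E F} {p : E} {q : F}
    (h : IsDiffeoGerm e p q) : ContDiffAt ℝ ∞ e p :=
  h.smooth.contDiffAt (e.open_source.mem_nhds h.mem_source)

/-- The inverse function theorem for germs. -/
lemma exists_isDiffeoGerm [CompleteSpace E] {f : E → F} {p : E}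
    (hf : ∀ᶠ x in 𝓝 p, ContDiffAt ℝ ∞ f x) {f' : E ≃L[ℝ] F}
    (hf' : HasFDerivAt f (f' : E →L[ℝ] F) p) :
    ∃ e : OpenPartialHomeomorph E F, (e : E → F) = f ∧ IsDiffeoGerm e p (f p) := by
  have hfp := hf.self_of_nhds
  let e₀ := hfp.toOpenPartialHomeomorph f hf' (by simp)
  have he₀ : p ∈ e₀.source := hfp.mem_toOpenPartialHomeomorph_source hf' (by simp)
  have hc : ContinuousAt (fderiv ℝ f) p := (hfp.fderiv_right (m := 0) (by simp)).continuousAt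
  -- The source is shrunk to points where f is smooth with invertible derivative, so that the
  -- inverse is smooth on the whole target and not only at f(p).
  have hev : ∀ᶠ x in 𝓝 p, ContDiffAt ℝ ∞ f x ∧
      fderiv ℝ f x ∈ Set.range ((↑) : (E ≃L[ℝ] F) → E →L[ℝ] F) := by
    refine hf.and (hc.eventually (ContinuousLinearEquiv.isOpen.mem_nhds ?_))
    exact ⟨f', hf'.fderiv.symm⟩
  obtain ⟨U, hU, hUo, hpU⟩ := eventually_nhds_iff.1 hev
  refine ⟨e₀.restrOpen U hUo, rfl, ?_, rfl, ?_, ?_⟩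
  · rw [OpenPartialHomeomorph.restrOpen_source]
    exact ⟨he₀, hpU⟩
  · rw [OpenPartialHomeomorph.restrOpen_source]
    exact fun x hx => (hU x hx.2).1.contDiffWithinAt
  · intro y hy
    have hx := (e₀.restrOpen U hUo).map_target hy
    rw [OpenPartialHomeomorph.restrOpen_source] at hx
    obtain ⟨L, hL⟩ := (hU _ hx.2).2
    refine ContDiffAt.contDiffWithinAt (OpenPartialHomeomorph.contDiffAt_symm _ hy (f₀' := L)
      ?_ (hU _ hx.2).1)
    rw [hL]
    exact ((hU _ hx.2).1.differentiableAt (by simp)).hasFDerivAt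

lemma AEquivalentAt.trans {f : E → F} {g : E → F} {h : E → F} {p q r : E}
    (hfg : AEquivalentAt f p g q) (hgh : AEquivalentAt g q h r) : AEquivalentAt f p h r := by
  obtain ⟨φ, Φ, hφ, hΦ, hev⟩ := hfg
  obtain ⟨φ', Φ', hφ', hΦ', hev'⟩ := hgh
  refine ⟨φ.trans φ', Φ.trans Φ', hφ.trans hφ', hΦ.trans hΦ', ?_⟩
  have ht := hφ'.symm.continuousAt.tendsto
  rw [hφ'.symm.map_base] at ht
  filter_upwards [hev', ht.eventually hev] with s hs hs'
  simp [hs, hs']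

/-- Continuity of f keeps its values near p inside the source of Φ, where Φ can be undone. -/
lemma AEquivalentAt.symm {f : E → F} {g : E → F} {p q : E} (hf : ContinuousAt f p)
    (h : AEquivalentAt f p g q) : AEquivalentAt g q f p := by
  obtain ⟨φ, Φ, hφ, hΦ, hev⟩ := h
  refine ⟨φ.symm, Φ.symm, hφ.symm, hΦ.symm, ?_⟩
  have ht := hφ.continuousAt.tendsto
  rw [hφ.map_base] at ht
  filter_upwards [ht.eventually hev, φ.open_source.mem_nhds hφ.mem_source,
    hf.eventually (Φ.open_source.mem_nhds hΦ.mem_source)] with s hs hs' hs''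
  rw [OpenPartialHomeomorph.symm_symm, hs, φ.left_inv hs', Φ.left_inv hs'']

end Germs

lemma exists_isDiffeoGerm_plane {Φ : Plane → Plane} {p : Plane}
    (hΦ : ContDiff ℝ ∞ Φ) {a b : Plane →L[ℝ] ℝ} (ha : HasFDerivAt (fun x => Φ x 0) a p)
    (hb : HasFDerivAt (fun x => Φ x 1) b p) (hab : ∀ v, a v = 0 → b v = 0 → v = 0) :
    ∃ e : OpenPartialHomeomorph Plane Plane, (e : Plane → Plane) = Φ ∧
      IsDiffeoGerm e p (Φ p) := by
  have hd := ((hΦ.differentiable (by simp)) p).hasFDerivAt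
  have h0 : ∀ v, fderiv ℝ Φ p v 0 = a v := fun v =>
    congrArg (fun L : Plane →L[ℝ] ℝ => L v) ((((EuclideanSpace.proj (𝕜 := ℝ) (0 : Fin 2)).hasFDerivAt.comp p hd).unique ha))
  have h1 : ∀ v, fderiv ℝ Φ p v 1 = b v := fun v =>
    congrArg (fun L : Plane →L[ℝ] ℝ => L v) ((((EuclideanSpace.proj (𝕜 := ℝ) (1 : Fin 2)).hasFDerivAt.comp p hd).unique hb))
  have hinj : Function.Injective (fderiv ℝ Φ p : Plane →ₗ[ℝ] Plane) := by
    rw [← LinearMap.ker_eq_bot, LinearMap.ker_eq_bot']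
    intro v hv
    have hv' : fderiv ℝ Φ p v = 0 := hv
    exact hab v (by rw [← h0, hv']; rfl) (by rw [← h1, hv']; rfl)
  refine exists_isDiffeoGerm (Filter.Eventually.of_forall fun x => hΦ.contDiffAt)
    (f' := (LinearEquiv.ofInjectiveEndo _ hinj).toContinuousLinearEquiv) ?_
  refine hd.congr_fderiv ?_
  ext v
  rfl

/-- A curve is `𝒜`-equivalent to its image under a change of coordinates and parameter. -/
lemma aequivalentAt_of_eventuallyEq {γ g : ℝ → Plane} {p q : ℝ} {Φ : Plane → Plane}
    (hΦ : ContDiff ℝ ∞ Φ) {a b : Plane →L[ℝ] ℝ} (ha : HasFDerivAt (fun x => Φ x 0) a (γ p))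
    (hb : HasFDerivAt (fun x => Φ x 1) b (γ p)) (hab : ∀ v, a v = 0 → b v = 0 → v = 0)
    {σ : ℝ → ℝ} (hσ : ContDiff ℝ ∞ σ) (hσq : σ q = p) (hσ' : deriv σ q ≠ 0)
    (hg : ∀ᶠ s in 𝓝 q, g s = Φ (γ (σ s))) : AEquivalentAt γ p g q := by
  obtain ⟨e, he, heg⟩ := exists_isDiffeoGerm_plane hΦ ha hb hab
  obtain ⟨φ, hφ, hφg⟩ := exists_isDiffeoGerm (Filter.Eventually.of_forall fun x => hσ.contDiffAt)
    ((hσ.hasDerivAt_infty q).hasFDerivAt_equiv hσ')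
  rw [hσq] at hφg
  refine ⟨φ.symm, e, hφg.symm, ?_, ?_⟩
  · rwa [hg.self_of_nhds, hσq]
  · simpa [he, hφ] using hg

lemma contDiff_coord (i : Fin 2) : ContDiff ℝ ∞ fun x : Plane => x i :=
  (EuclideanSpace.proj (𝕜 := ℝ) i).contDiff

lemma hasFDerivAt_coord (i : Fin 2) (p : Plane) :
    HasFDerivAt (fun x : Plane => x i) (EuclideanSpace.proj i : Plane →L[ℝ] ℝ) p :=
  (EuclideanSpace.proj (𝕜 := ℝ) i).hasFDerivAt

/-- Coordinate changes `(x, y) ↦ (x, F(x, y))`. -/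
lemma aequivalentAt_of_shear {g₀ g₁ : ℝ → Plane} (hg₀ : g₀ 0 = 0) {F : ℝ → ℝ → ℝ}
    (hF : ContDiff ℝ ∞ fun x : Plane => F (x 0) (x 1)) {c : ℝ} (hc : c ≠ 0)
    (hFc : HasDerivAt (F 0) c 0) (h : ∀ t, g₁ t = !₂[g₀ t 0, F (g₀ t 0) (g₀ t 1)]) :
    AEquivalentAt g₀ 0 g₁ 0 := by
  have hb := ((hF.differentiable (by simp)) 0).hasFDerivAt
  have hb1 : fderiv ℝ (fun x : Plane => F (x 0) (x 1)) 0 (EuclideanSpace.single 1 1) ≠ 0 := by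
    have hl : HasDerivAt (fun y : ℝ => y • (EuclideanSpace.single 1 1 : Plane))
        (EuclideanSpace.single 1 1) 0 := by
      simpa using (hasDerivAt_id (0 : ℝ)).smul_const (EuclideanSpace.single 1 1 : Plane)
    have hb' := hb
    rw [← zero_smul ℝ (EuclideanSpace.single 1 1 : Plane)] at hb'
    have := hb'.comp_hasDerivAt (0 : ℝ) hl
    rw [zero_smul] at this
    have h2 := this.unique (hFc.congr_of_eventuallyEq
      (Filter.Eventually.of_forall fun y => by simp))
    rwa [h2]
  refine aequivalentAt_of_eventuallyEq (Φ := fun x => !₂[x 0, F (x 0) (x 1)]) (σ := id)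
    (a := EuclideanSpace.proj 0) ?_ ?_ (by rw [hg₀]; exact hb) ?_ contDiff_id rfl (by simp)
    (Filter.Eventually.of_forall h)
  · rw [contDiff_euclidean]
    intro i
    fin_cases i
    · exact contDiff_coord 0
    · exact hF
  · exact hasFDerivAt_coord 0 _
  · intro v hv hv'
    have hv0 : v 0 = 0 := hv
    have hv1 : v = v 1 • EuclideanSpace.single 1 1 := by
      ext i
      fin_cases i <;> simp [hv0]
    rw [hv1, map_smul, smul_eq_mul, mul_eq_zero] at hv'
    rw [hv1, hv'.resolve_right hb1, zero_smul]

/-! ### Extension of germs, reparametrizations and roots -/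

/-- A smooth germ extends to a global smooth function. -/
lemma exists_contDiff_eventuallyEq {f : ℝ → ℝ} {p : ℝ}
    (hf : ∀ᶠ x in 𝓝 p, ContDiffAt ℝ ∞ f x) : ∃ g : ℝ → ℝ, ContDiff ℝ ∞ g ∧ g =ᶠ[𝓝 p] f := by
  obtain ⟨r, hr, hball⟩ := Metric.eventually_nhds_iff_ball.1 hf
  let χ : ContDiffBump p := ⟨r / 4, r / 2, by positivity, by linarith⟩
  refine ⟨fun x => χ x * f x, contDiff_iff_contDiffAt.2 fun x => ?_, ?_⟩
  · by_cases hx : x ∈ tsupport χ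
    · refine χ.contDiff.contDiffAt.mul (hball x ?_)
      rw [χ.tsupport_eq] at hx
      exact Metric.closedBall_subset_ball (by simp only [χ]; linarith) hx
    · refine (contDiffAt_const (c := 0)).congr_of_eventuallyEq ?_
      filter_upwards [notMem_tsupport_iff_eventuallyEq.1 hx] with y hy
      simp [hy]
  · filter_upwards [χ.eventuallyEq_one] with x hx
    simp [hx]

lemma Continuous.eq_of_eventually_mul_eq {f g : ℝ → ℝ} (hf : Continuous f) (hg : Continuous g)
    (h : ∀ᶠ s in 𝓝 0, s * f s = s * g s) : f =ᶠ[𝓝 0] g := by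
  have h' : ∀ᶠ s in 𝓝[≠] 0, f s = g s := by
    filter_upwards [h.filter_mono nhdsWithin_le_nhds, self_mem_nhdsWithin] with s hs hs0
    exact mul_left_cancel₀ hs0 hs
  have h0 : f 0 = g 0 := tendsto_nhds_unique_of_eventuallyEq
    (hf.continuousAt.tendsto.mono_left nhdsWithin_le_nhds)
    (hg.continuousAt.tendsto.mono_left nhdsWithin_le_nhds) h'
  rw [eventually_nhdsWithin_iff] at h'
  filter_upwards [h'] with s hs
  by_cases hs0 : s = 0
  · rw [hs0, h0]
  · exact hs hs0

/-- The inverse of the change of parameter `t ↦ t B(t)`. -/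
lemma exists_reparametrization {B : ℝ → ℝ} (hB : ContDiff ℝ ∞ B) (hB0 : B 0 ≠ 0) :
    ∃ σ v : ℝ → ℝ, ContDiff ℝ ∞ σ ∧ ContDiff ℝ ∞ v ∧ (∀ s, σ s = s * v s) ∧
      (∀ᶠ s in 𝓝 0, v s * B (σ s) = 1) ∧ deriv σ 0 ≠ 0 := by
  have hτ : ContDiff ℝ ∞ fun t => t * B t := contDiff_id.mul hB
  have hd : HasDerivAt (fun t => t * B t) (B 0) 0 := by
    simpa using (hasDerivAt_id' (0 : ℝ)).fun_mul (hB.hasDerivAt_infty 0)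
  obtain ⟨e, he, heg⟩ := exists_isDiffeoGerm (Filter.Eventually.of_forall fun x => hτ.contDiffAt)
    (hd.hasFDerivAt_equiv hB0)
  rw [zero_mul] at heg
  have htgt : e.target ∈ 𝓝 (0 : ℝ) := e.open_target.mem_nhds heg.symm.mem_source
  obtain ⟨σ, hσ, hσe⟩ := exists_contDiff_eventuallyEq (f := e.symm) (p := 0) (by
    filter_upwards [e.open_target.eventually_mem heg.symm.mem_source] with y hy
    exact heg.smooth_symm.contDiffAt (e.open_target.mem_nhds hy))
  have hσ0 : σ 0 = 0 := by rw [hσe.eq_of_nhds, heg.symm.map_base]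
  obtain ⟨v, hv, hσv⟩ := exists_eq_add_mul hσ
  have hσv' : ∀ s, σ s = s * v s := fun s => by rw [hσv s, hσ0, zero_add]
  have hinv : ∀ᶠ s in 𝓝 0, v s * B (σ s) = 1 := by
    refine Continuous.eq_of_eventually_mul_eq (g := fun _ => 1)
      (hv.mul (hB.comp hσ)).continuous continuous_const ?_
    filter_upwards [hσe, htgt] with s hs hs'
    have := e.right_inv hs'
    rw [he, ← hs] at this
    simp only at this
    rw [← mul_assoc, ← hσv', this, mul_one]
  refine ⟨σ, v, hσ, hv, hσv', hinv, ?_⟩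
  have h1 := hinv.self_of_nhds
  have h2 : HasDerivAt σ (v 0) 0 := by
    rw [show σ = fun s => s * v s from funext hσv']
    simpa using (hasDerivAt_id' (0 : ℝ)).fun_mul (hv.hasDerivAt_infty 0)
  rw [h2.deriv]
  exact left_ne_zero_of_mul_eq_one h1

lemma exists_root {A : ℝ → ℝ} (hA : ContDiff ℝ ∞ A) (hA0 : A 0 = 1) {i : ℕ} (hi : i ≠ 0) :
    ∃ B : ℝ → ℝ, ContDiff ℝ ∞ B ∧ B 0 = 1 ∧ ∀ᶠ t in 𝓝 0, B t ^ i = A t := by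
  have hpos : ∀ᶠ t in 𝓝 0, 0 < A t :=
    hA.continuous.continuousAt.eventually (lt_mem_nhds (by rw [hA0]; exact one_pos))
  obtain ⟨B, hB, hBA⟩ := exists_contDiff_eventuallyEq (f := fun t => A t ^ ((i : ℝ)⁻¹)) (p := 0) (by
    filter_upwards [hpos] with t ht
    exact hA.contDiffAt.rpow_const_of_ne ht.ne')
  refine ⟨B, hB, by rw [hBA.eq_of_nhds, hA0, Real.one_rpow], ?_⟩
  filter_upwards [hBA, hpos] with t ht ht'
  rw [ht, Real.rpow_inv_natCast_pow ht'.le hi]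

/-! ### Determinacy of the model cusps -/

/-- The plane curve germ `t ↦ (tⁱ, tʲ k(t))`. -/
noncomputable def monomialCurve (i j : ℕ) (k : ℝ → ℝ) (t : ℝ) : Plane := !₂[t ^ i, t ^ j * k t]

lemma monomialCurve_zero {i j : ℕ} (hi : i ≠ 0) (hj : j ≠ 0) (k : ℝ → ℝ) :
    monomialCurve i j k 0 = 0 := by
  ext l
  fin_cases l <;> simp [monomialCurve, hi, hj]

lemma contDiff_monomialCurve (i j : ℕ) {k : ℝ → ℝ} (hk : ContDiff ℝ ∞ k) :
    ContDiff ℝ ∞ (monomialCurve i j k) := by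
  rw [contDiff_euclidean]
  intro l
  fin_cases l
  · exact contDiff_id.pow i
  · exact (contDiff_id.pow j).mul hk

/-- If k = a(t²) + t b(t²), then on the model curve (x, y) = (t², t²ᵐ⁺¹) the function t²ᵐ⁺¹ k equals
y a(x) + xᵐ⁺¹ b(x). This shear carries the model to the given curve, hence the use of symmetry. -/
lemma monomialCurve_two_equiv (m : ℕ) {k : ℝ → ℝ} (hk : ContDiff ℝ ∞ k) (hk0 : k 0 ≠ 0) :
    AEquivalentAt (monomialCurve 2 (2 * m + 1) k) 0 (monomialCurve 2 (2 * m + 1) fun _ => 1) 0 := by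
  obtain ⟨a, b, ha, hb, hab⟩ := exists_quadratic_decomposition hk
  have ha0 : a 0 ≠ 0 := by simpa [hab 0] using hk0
  refine AEquivalentAt.symm (contDiff_monomialCurve _ _ contDiff_const).continuous.continuousAt ?_
  refine aequivalentAt_of_shear (F := fun x y => y * a x + x ^ (m + 1) * b x) (c := a 0)
    (monomialCurve_zero two_ne_zero (by simp) _) ?_ ha0 ?_ fun t => ?_
  · exact ((contDiff_coord 1).mul (ha.comp (contDiff_coord 0))).add
      (((contDiff_coord 0).pow _).mul (hb.comp (contDiff_coord 0)))
  · simpa using (hasDerivAt_id' (0 : ℝ)).mul_const (a 0)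
  · simp only [monomialCurve, hab t]
    congr 2
    simp
    ring

/-- The change of parameter removing the gap exponent `2 j - 3` of the semigroup `⟨3, j⟩`. -/
lemma monomialCurve_three_equiv_gap {d j : ℕ} (hd : d ≠ 0) (hj : j = d + 3) {a : ℝ} (ha : a ≠ 0)
    {c : ℝ → ℝ} (hc : ContDiff ℝ ∞ c) :
    ∃ E : ℝ → ℝ, ContDiff ℝ ∞ E ∧ E 0 = 0 ∧
      AEquivalentAt (monomialCurve 3 j fun t => a + t ^ d * c t) 0
        (monomialCurve 3 j fun t => a + t ^ d * E t) 0 := by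
  have hj0 : j ≠ 0 := by omega
  have hjR : (j : ℝ) ≠ 0 := by exact_mod_cast hj0
  set k : ℝ → ℝ := fun t => a + t ^ d * c t with hk_def
  have hk : ContDiff ℝ ∞ k := contDiff_const.add ((contDiff_id.pow d).mul hc)
  have hk0 : k 0 = a := by simp [hk_def, hd]
  -- The shear x + α y = t³ (1 + α tᵈ k) has the cube root s = t B(t), so that t = s (1 - (α a / 3)
  -- sᵈ + ...). This adds -j α a² / 3 to the coefficient c(0) of y at exponent j + d = 2j - 3, and α
  -- is chosen to cancel it.
  set α : ℝ := 3 * c 0 / (j * a ^ 2) with hα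
  have hA : ContDiff ℝ ∞ fun t => 1 + t ^ d * (α * k t) :=
    contDiff_const.add ((contDiff_id.pow d).mul (contDiff_const.mul hk))
  obtain ⟨B, hB, hB0, hBA⟩ := exists_root hA (by simp [hd]) three_ne_zero
  have hpos : ∀ t, 1 + B t + B t ^ 2 ≠ 0 := fun t => by nlinarith [sq_nonneg (B t + 1 / 2)]
  -- W is (B - 1) / tᵈ, read off from B³ - 1 = (B - 1)(1 + B + B²).
  set W : ℝ → ℝ := fun t => α * k t / (1 + B t + B t ^ 2) with hW_def
  have hW : ContDiff ℝ ∞ W :=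
    (contDiff_const.mul hk).div ((contDiff_const.add hB).add (hB.pow 2)) hpos
  have hBW : ∀ᶠ t in 𝓝 0, B t = 1 + t ^ d * W t := by
    filter_upwards [hBA] with t ht
    have := hpos t
    simp only [hW_def]
    field_simp
    linear_combination ht
  obtain ⟨σ, v, hσ, hv, hσv, hinv, hσ'⟩ := exists_reparametrization hB (by rw [hB0]; exact one_ne_zero)
  have hσ0 : σ 0 = 0 := by rw [hσv, zero_mul]
  have hv0 : v 0 = 1 := by simpa [hσ0, hB0] using hinv.self_of_nhds
  set V : ℝ → ℝ := fun s => -v s ^ (d + 1) * W (σ s) with hV_def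
  have hV : ContDiff ℝ ∞ V := (hv.pow _).neg.mul (hW.comp hσ)
  have hσt : Filter.Tendsto σ (𝓝 0) (𝓝 0) := by
    simpa [hσ0] using hσ.continuous.tendsto 0
  have hvV : ∀ᶠ s in 𝓝 0, v s - 1 = s ^ d * V s := by
    filter_upwards [hinv, hσt.eventually hBW] with s hs hs'
    rw [hs'] at hs
    have : σ s ^ d = s ^ d * v s ^ d := by rw [hσv, mul_pow]
    simp only [hV_def, pow_succ]
    rw [this] at hs
    linear_combination hs
  -- Here vʲ - 1 is expanded as (v - 1) times a geometric sum, with v - 1 = sᵈ V.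
  set E : ℝ → ℝ := fun s =>
    a * V s * ∑ m ∈ Finset.range j, v s ^ m + v s ^ (j + d) * c (σ s) with hE_def
  refine ⟨E, ?_, ?_, ?_⟩
  · exact ((contDiff_const.mul hV).mul (ContDiff.sum fun m _ => hv.pow m)).add
      ((hv.pow _).mul (hc.comp hσ))
  · simp only [hE_def, hV_def, hW_def, hσ0, hv0, hB0, hk0, one_pow, Finset.sum_const,
      Finset.card_range, nsmul_eq_mul, hα]
    field_simp
    ring
  refine aequivalentAt_of_eventuallyEq (Φ := fun x => !₂[x 0 + α * x 1, x 1])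
    (a := EuclideanSpace.proj 0 + α • EuclideanSpace.proj 1) (b := EuclideanSpace.proj 1)
    ?_ ?_ ?_ ?_ hσ hσ0 hσ' ?_
  · rw [contDiff_euclidean]
    intro i
    fin_cases i
    · exact (contDiff_coord 0).add (contDiff_const.mul (contDiff_coord 1))
    · exact contDiff_coord 1
  · exact (hasFDerivAt_coord 0 _).add ((hasFDerivAt_coord 1 _).const_mul α)
  · exact hasFDerivAt_coord 1 _
  · intro x hx hx'
    have h1 : x 1 = 0 := hx'
    have h0 : x 0 + α * x 1 = 0 := hx
    ext i
    fin_cases i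
    · simpa [h1] using h0
    · exact h1
  · filter_upwards [hinv, hvV, hσt.eventually hBA] with s hs hs' hs''
    have hcube : s ^ 3 = σ s ^ 3 * B (σ s) ^ 3 := by
      rw [← mul_pow, hσv, mul_assoc, ← hσv, hs, mul_one]
    have hgeom := geom_sum_mul (v s) j
    rw [hs'] at hgeom
    simp only [monomialCurve]
    ext i
    fin_cases i
    · simp only [Fin.zero_eta, Matrix.cons_val_zero, Matrix.cons_val_one]
      rw [hcube, hs'', hj, pow_add]
      ring
    · simp only [Fin.mk_one, Matrix.cons_val_one, Matrix.cons_val_fin_one]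
      simp only [hk_def, hE_def]
      have h1 : σ s ^ j = s ^ j * v s ^ j := by rw [hσv, mul_pow]
      have h2 : σ s ^ d = s ^ d * v s ^ d := by rw [hσv, mul_pow]
      rw [h1, h2, pow_add]
      linear_combination s ^ j * a * hgeom

lemma monomialCurve_three_four_equiv {k : ℝ → ℝ} (hk : ContDiff ℝ ∞ k) (hk0 : k 0 ≠ 0) :
    AEquivalentAt (monomialCurve 3 4 k) 0 (monomialCurve 3 4 fun _ => 1) 0 := by
  obtain ⟨c, hc, hkc⟩ := exists_eq_add_mul hk
  obtain ⟨E, hE, hE0, h⟩ := monomialCurve_three_equiv_gap one_ne_zero (j := 4) rfl hk0 hc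
  simp only [pow_one, ← hkc] at h
  refine h.trans ?_
  obtain ⟨e₀, e₁, e₂, he₀, he₁, he₂, he⟩ := exists_cubic_decomposition hE
  obtain ⟨f, hf, hef⟩ := exists_eq_add_mul he₀
  have he00 : e₀ 0 = 0 := by simpa [hE0] using (he 0).symm
  refine AEquivalentAt.symm (contDiff_monomialCurve _ _ contDiff_const).continuous.continuousAt ?_
  -- On (t³, t⁴) the correction t⁵ E splits into t⁵ e₀ + t⁶ e₁ + t⁷ e₂. Since e₀(0) = 0, the gap
  -- term t⁵ e₀ is t⁸ f = y² f(x); the others are x² e₁(x) and x y e₂(x).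
  refine aequivalentAt_of_shear (c := k 0)
    (F := fun x y => k 0 * y + y ^ 2 * f x + x ^ 2 * e₁ x + x * y * e₂ x)
    (monomialCurve_zero three_ne_zero (by simp) _) ?_ hk0 ?_ fun t => ?_
  · exact (((contDiff_const.mul (contDiff_coord 1)).add
      (((contDiff_coord 1).pow _).mul (hf.comp (contDiff_coord 0)))).add
      (((contDiff_coord 0).pow _).mul (he₁.comp (contDiff_coord 0)))).add
      (((contDiff_coord 0).mul (contDiff_coord 1)).mul (he₂.comp (contDiff_coord 0)))
  · simpa using ((hasDerivAt_id' (0 : ℝ)).const_mul (k 0)).fun_add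
      (((hasDerivAt_id' (0 : ℝ)).pow 2).mul_const (f 0))
  · simp only [monomialCurve, he t, hef (t ^ 3), he00]
    congr 2
    simp
    ring

lemma monomialCurve_three_five_equiv {k : ℝ → ℝ} (hk : ContDiff ℝ ∞ k) (hk0 : k 0 ≠ 0) :
    AEquivalentAt (monomialCurve 3 5 k) 0 (monomialCurve 3 5 fun _ => 1) 0 := by
  obtain ⟨c₁, hc₁, hkc₁⟩ := exists_eq_add_mul hk
  obtain ⟨c, hc, hc₁c⟩ := exists_eq_add_mul hc₁
  -- The exponent 6 lies in the semigroup, t⁶ being x², and is removed first so that the gap 7 comes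
  -- next.
  have hshear : AEquivalentAt (monomialCurve 3 5 k) 0
      (monomialCurve 3 5 fun t => k 0 + t ^ 2 * c t) 0 := by
    refine aequivalentAt_of_shear (c := 1) (F := fun x y => y - c₁ 0 * x ^ 2)
      (monomialCurve_zero three_ne_zero (by simp) _) ?_ one_ne_zero ?_ fun t => ?_
    · exact (contDiff_coord 1).sub (contDiff_const.mul ((contDiff_coord 0).pow 2))
    · simpa using hasDerivAt_id' (0 : ℝ)
    · simp only [monomialCurve]
      congr 2
      simp [hkc₁ t, hc₁c t]
      ring
  refine hshear.trans ?_
  obtain ⟨E, hE, hE0, h⟩ := monomialCurve_three_equiv_gap two_ne_zero (j := 5) rfl hk0 hc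
  refine h.trans ?_
  obtain ⟨e₀, e₁, e₂, he₀, he₁, he₂, he⟩ := exists_cubic_decomposition hE
  obtain ⟨f, hf, hef⟩ := exists_eq_add_mul he₀
  have he00 : e₀ 0 = 0 := by simpa [hE0] using (he 0).symm
  refine AEquivalentAt.symm (contDiff_monomialCurve _ _ contDiff_const).continuous.continuousAt ?_
  -- The correction t⁷ E contributes t¹⁰ f = y² f(x), t⁸ e₁ = x y e₁(x) and t⁹ e₂ = x³ e₂(x).
  refine aequivalentAt_of_shear (c := k 0)
    (F := fun x y => k 0 * y + y ^ 2 * f x + x * y * e₁ x + x ^ 3 * e₂ x)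
    (monomialCurve_zero three_ne_zero (by simp) _) ?_ hk0 ?_ fun t => ?_
  · exact (((contDiff_const.mul (contDiff_coord 1)).add
      (((contDiff_coord 1).pow _).mul (hf.comp (contDiff_coord 0)))).add
      (((contDiff_coord 0).mul (contDiff_coord 1)).mul (he₁.comp (contDiff_coord 0)))).add
      (((contDiff_coord 0).pow _).mul (he₂.comp (contDiff_coord 0)))
  · simpa using ((hasDerivAt_id' (0 : ℝ)).const_mul (k 0)).fun_add
      (((hasDerivAt_id' (0 : ℝ)).pow 2).mul_const (f 0))
  · simp only [monomialCurve, he t, hef (t ^ 3), he00]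
    congr 2
    simp
    ring

/-! ### Invariants obstructing 𝒜-equivalence -/

lemma Polynomial.coeff_eq_zero_of_isBigO (P : Polynomial ℝ) {n : ℕ}
    (h : (fun t => P.eval t) =O[𝓝[≠] 0] fun t => t ^ n) {k : ℕ} (hk : k < n) : P.coeff k = 0 := by
  induction n generalizing P k with
  | zero => omega
  | succ n ih =>
    have hlim : Filter.Tendsto (fun t => P.eval t) (𝓝[≠] 0) (𝓝 0) :=
      h.trans_tendsto (((continuous_pow (n + 1)).tendsto' 0 0 (by simp)).mono_left
        nhdsWithin_le_nhds)
    have h0 : P.coeff 0 = 0 := by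
      rw [Polynomial.coeff_zero_eq_eval_zero]
      exact tendsto_nhds_unique (P.continuous.continuousAt.tendsto.mono_left nhdsWithin_le_nhds) hlim
    have hP : P = P.divX * Polynomial.X := by
      conv_lhs => rw [← Polynomial.divX_mul_X_add P, h0]
      simp
    cases k with
    | zero => exact h0
    | succ k =>
      rw [← Polynomial.coeff_divX]
      refine ih P.divX ?_ (by omega)
      obtain ⟨C, hC⟩ := h.bound
      refine Asymptotics.IsBigO.of_bound C ?_
      filter_upwards [hC, self_mem_nhdsWithin] with t ht ht0
      rw [hP, Polynomial.eval_mul, Polynomial.eval_X, norm_mul, pow_succ, norm_mul,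
        ← mul_assoc] at ht
      exact le_of_mul_le_mul_right ht (norm_pos_iff.2 ht0)

lemma not_isBigO_pow_succ (n : ℕ) :
    ¬ (fun t : ℝ => t ^ n) =O[𝓝[≠] 0] fun t : ℝ => t ^ (n + 1) := by
  intro h
  have := Polynomial.coeff_eq_zero_of_isBigO (Polynomial.X ^ n) (n := n + 1) (k := n)
    (by simpa using h) (Nat.lt_succ_self n)
  simp at this

lemma isBigO_pow_of_le {m n : ℕ} (h : m ≤ n) :
    (fun t : ℝ => t ^ n) =O[𝓝 0] fun t : ℝ => t ^ m := by
  refine Asymptotics.IsBigO.of_bound 1 ?_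
  filter_upwards [Metric.closedBall_mem_nhds (0 : ℝ) one_pos] with t ht
  rw [norm_pow, norm_pow, one_mul]
  exact pow_le_pow_of_le_one (norm_nonneg _) (by simpa using ht) h

lemma ContDiffAt.isBigO_sub_comp {E F : Type*} [NormedAddCommGroup E] [NormedSpace ℝ E]
    [NormedAddCommGroup F] [NormedSpace ℝ F] {Φ : E → F} {p : E}
    (hΦ : ContDiffAt ℝ ∞ Φ p) {a b : ℝ → E} {q : ℝ} (ha : Filter.Tendsto a (𝓝 q) (𝓝 p))
    (hb : Filter.Tendsto b (𝓝 q) (𝓝 p)) :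
    (fun t => Φ (a t) - Φ (b t)) =O[𝓝 q] fun t => a t - b t := by
  obtain ⟨K, s, hs, hK⟩ := (hΦ.of_le (m := 1) (by simp)).exists_lipschitzOnWith
  refine Asymptotics.IsBigO.of_bound K ?_
  filter_upwards [ha.eventually hs, hb.eventually hs] with t hat hbt
  exact hK.norm_sub_le hat hbt

lemma IsDiffeoGerm.isBigO_symm_sub {φ : OpenPartialHomeomorph ℝ ℝ} {p q : ℝ}
    (h : IsDiffeoGerm φ p q) : (fun s => φ.symm s - p) =O[𝓝 q] fun s => s - q := by
  have := h.symm.contDiffAt.isBigO_sub_comp (a := id) (b := fun _ => q) Filter.tendsto_id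
    tendsto_const_nhds
  simpa [h.symm.map_base] using this

/-- Curves vanishing to order `i + 1` are not `𝒜`-equivalent to curves of multiplicity `i`. -/
lemma not_aequivalentAt_of_isBigO {γ : ℝ → Plane} {p : ℝ} {i j : ℕ} (hi : i ≠ 0) {k : ℝ → ℝ}
    (hγ : (fun t => γ t - γ p) =O[𝓝 p] fun t => (t - p) ^ (i + 1)) :
    ¬ AEquivalentAt γ p (monomialCurve i j k) 0 := by
  rintro ⟨φ, Φ, hφ, hΦ, hev⟩
  have hγc : Filter.Tendsto γ (𝓝 p) (𝓝 (γ p)) := by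
    rw [tendsto_iff_norm_sub_tendsto_zero, ← tendsto_zero_iff_norm_tendsto_zero]
    exact hγ.trans_tendsto (Continuous.tendsto' (by fun_prop) _ _ (by simp))
  have hσt : Filter.Tendsto φ.symm (𝓝 0) (𝓝 p) := by
    simpa [hφ.symm.map_base] using hφ.symm.continuousAt.tendsto
  have h1 := hΦ.contDiffAt.isBigO_sub_comp (hγc.comp hσt) (tendsto_const_nhds (x := γ p))
  have h2 : (fun s => γ (φ.symm s) - γ p) =O[𝓝 0] fun s : ℝ => s ^ (i + 1) := by
    refine (hγ.comp_tendsto hσt).trans ?_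
    simpa [Function.comp_def] using hφ.isBigO_symm_sub.pow (i + 1)
  -- Φ is locally Lipschitz, so it cannot lower the order of vanishing, yet the first coordinate of
  -- the target is sⁱ.
  have h3 : (fun s : ℝ => s ^ i) =O[𝓝 0] fun s : ℝ => s ^ (i + 1) := by
    refine Asymptotics.IsBigO.trans ?_ (h1.trans h2)
    refine Asymptotics.IsBigO.of_bound 1 ?_
    filter_upwards [hev] with s hs
    simp only [Function.comp_apply]
    rw [← hs, hΦ.map_base, one_mul]
    refine le_trans (le_of_eq ?_) (PiLp.norm_apply_le _ 0)
    simp [monomialCurve, hi]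
  exact not_isBigO_pow_succ i (h3.mono nhdsWithin_le_nhds)

/-- The exponent `j` is not in the semigroup of a curve `(tⁱ, O(tʲ⁺¹))` when `i ∤ j`. -/
lemma not_aequivalentAt_monomialCurve {i j : ℕ} (hi : 2 ≤ i) (hij : ¬ i ∣ j) {r : ℝ → ℝ}
    (hr : ContDiff ℝ ∞ r) :
    ¬ AEquivalentAt (monomialCurve i (j + 1) r) 0 (monomialCurve i j fun _ => 1) 0 := by
  have hi0 : i ≠ 0 := by omega
  have hj0 : j ≠ 0 := fun h => hij (h ▸ dvd_zero i)
  rintro ⟨φ, Φ, hφ, hΦ, hev⟩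
  rw [monomialCurve_zero hi0 (Nat.succ_ne_zero j)] at hΦ
  let ι : ℝ → Plane := fun x => x • EuclideanSpace.single 0 1
  have hι : ContDiff ℝ ∞ ι := contDiff_id.smul contDiff_const
  have hι0 : Filter.Tendsto ι (𝓝 0) (𝓝 0) := hι.continuous.tendsto' 0 0 (by simp [ι])
  obtain ⟨G, hG, hGe⟩ := exists_contDiff_eventuallyEq (f := fun x => Φ (ι x) 1) (p := 0) (by
    filter_upwards [hι0.eventually (Φ.open_source.mem_nhds hΦ.mem_source)] with x hx
    exact (contDiff_coord 1).contDiffAt.comp x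
      ((hΦ.smooth.contDiffAt (Φ.open_source.mem_nhds hx)).comp x hι.contDiffAt))
  obtain ⟨R, hR, hGR⟩ := exists_taylor hG j
  obtain ⟨w, hw, hwe⟩ := exists_contDiff_eventuallyEq (f := φ) (p := 0) (by
    filter_upwards [φ.open_source.eventually_mem hφ.mem_source] with x hx
    exact hφ.smooth.contDiffAt (φ.open_source.mem_nhds hx))
  have hw0 : w 0 = 0 := by rw [hwe.eq_of_nhds, hφ.map_base]
  obtain ⟨w₁, hw₁, hww₁⟩ := exists_eq_add_mul hw
  simp only [hw0, zero_add] at hww₁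
  have hφt : Filter.Tendsto φ (𝓝 0) (𝓝 0) := by
    simpa [hφ.map_base] using hφ.continuousAt.tendsto
  -- If φ'(0) were 0, then φ = O(t²), whereas t = O(φ) because the inverse is Lipschitz.
  have he : w₁ 0 ≠ 0 := by
    intro h
    obtain ⟨w₂, hw₂, hww₂⟩ := exists_eq_add_mul hw₁
    have h1 : (fun t : ℝ => t) =O[𝓝 0] φ := by
      refine (hφ.isBigO_symm_sub.comp_tendsto hφt).congr' ?_ (by simp [Function.comp_def])
      filter_upwards [φ.open_source.mem_nhds hφ.mem_source] with t ht
      simp [φ.left_inv ht]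
    have h2 : φ =O[𝓝 0] fun t : ℝ => t ^ 2 := by
      have : (fun t : ℝ => t ^ 2 * w₂ t) =O[𝓝 0] fun t : ℝ => t ^ 2 * (1 : ℝ) :=
        (Asymptotics.isBigO_refl _ _).mul ((hw₂.continuous.tendsto 0).isBigO_one ℝ)
      simp only [mul_one] at this
      refine this.congr' ?_ Filter.EventuallyEq.rfl
      filter_upwards [hwe] with t ht
      rw [← ht, hww₁, hww₂ t, h]
      ring
    have h3 := (h1.trans h2).mono nhdsWithin_le_nhds (l := 𝓝[≠] 0)
    exact not_isBigO_pow_succ 1 (by simpa using h3)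
  obtain ⟨z, hz, hwz⟩ := exists_eq_add_mul (hw₁.pow j)
  have hmono : Filter.Tendsto (monomialCurve i (j + 1) r) (𝓝 0) (𝓝 0) := by
    have := (contDiff_monomialCurve i (j + 1) hr).continuous.tendsto 0
    rwa [monomialCurve_zero hi0 (Nat.succ_ne_zero j)] at this
  have hpow : Filter.Tendsto (fun t : ℝ => t ^ i) (𝓝 0) (𝓝 0) :=
    (continuous_pow i).tendsto' 0 0 (by simp [hi0])
  have hdiff : (fun t => (Φ (monomialCurve i (j + 1) r t) - Φ (ι (t ^ i))) 1) =O[𝓝 0]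
      fun t : ℝ => t ^ (j + 1) := by
    have h1 := hΦ.contDiffAt.isBigO_sub_comp hmono (hι0.comp hpow)
    have h2 : (fun t => monomialCurve i (j + 1) r t - (ι ∘ fun t : ℝ => t ^ i) t) =O[𝓝 0]
        fun t : ℝ => t ^ (j + 1) * (1 : ℝ) := by
      have : (fun t => monomialCurve i (j + 1) r t - (ι ∘ fun t : ℝ => t ^ i) t) =
          fun t => (t ^ (j + 1) * r t) • (EuclideanSpace.single 1 1 : Plane) := by
        funext t
        ext l
        fin_cases l <;> simp [monomialCurve, ι]
      rw [this]
      refine Asymptotics.IsBigO.trans (g := fun t => t ^ (j + 1) * r t) ?_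
        ((Asymptotics.isBigO_refl _ _).mul ((hr.continuous.tendsto 0).isBigO_one ℝ))
      exact Asymptotics.IsBigO.of_bound 1 (Filter.Eventually.of_forall fun t => by
        simp [norm_smul])
    simp only [mul_one] at h2
    refine Asymptotics.IsBigO.trans ?_ (h1.trans h2)
    exact Asymptotics.IsBigO.of_bound 1 (Filter.Eventually.of_forall fun t => by
      rw [one_mul]
      exact PiLp.norm_apply_le _ 1)
  have hzO : (fun t => t ^ (j + 1) * z t) =O[𝓝 0] fun t : ℝ => t ^ (j + 1) := by
    simpa using (Asymptotics.isBigO_refl (fun t : ℝ => t ^ (j + 1)) (𝓝 0)).mul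
      ((hz.continuous.tendsto 0).isBigO_one ℝ)
  have hRO : (fun t => t ^ (i * j) * R (t ^ i)) =O[𝓝 0] fun t : ℝ => t ^ (j + 1) := by
    have h1 : (fun t => t ^ (i * j) * R (t ^ i)) =O[𝓝 0] fun t : ℝ => t ^ (i * j) * (1 : ℝ) :=
      (Asymptotics.isBigO_refl _ _).mul
        (((hR.continuous.tendsto 0).comp hpow).isBigO_one ℝ)
    simp only [mul_one] at h1
    refine h1.trans (isBigO_pow_of_le ?_)
    nlinarith [Nat.one_le_iff_ne_zero.2 hj0]
  -- The second coordinate of Φ along the curve is both φ(t)ʲ and G(tⁱ) + O(tʲ⁺¹), where G is that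
  -- coordinate on the x-axis. P is the difference of the leading parts. The G part contains only
  -- powers of tⁱ, so as i ∤ j the coefficient of tʲ in P is w₁(0)ʲ ≠ 0, contradicting P = O(tʲ⁺¹).
  let P : Polynomial ℝ := Polynomial.C (w₁ 0 ^ j) * Polynomial.X ^ j -
    ∑ m ∈ Finset.range j, Polynomial.C (iteratedDeriv m G 0 / m.factorial) *
      Polynomial.X ^ (i * m)
  have hP : (fun t => P.eval t) =O[𝓝 0] fun t : ℝ => t ^ (j + 1) := by
    refine ((hdiff.sub hzO).add hRO).congr' ?_ Filter.EventuallyEq.rfl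
    filter_upwards [hφt.eventually hev, φ.open_source.mem_nhds hφ.mem_source, hwe,
      hpow.eventually hGe] with t ht hts htw htG
    rw [φ.left_inv hts] at ht
    rw [← ht]
    have h1 : (monomialCurve i j (fun _ => 1) (φ t) - Φ (ι (t ^ i))) 1 = φ t ^ j - G (t ^ i) := by
      rw [htG]
      simp [monomialCurve]
    have h2 : φ t ^ j = t ^ j * (w₁ 0 ^ j + t * z t) := by
      rw [← htw, hww₁, mul_pow, ← hwz t]
    have h3 : P.eval t = w₁ 0 ^ j * t ^ j -
        ∑ m ∈ Finset.range j, iteratedDeriv m G 0 / m.factorial * t ^ (i * m) := by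
      simp [P, Polynomial.eval_finsetSum]
    rw [h1, h2, h3, hGR]
    simp only [← pow_mul]
    ring
  have hcoeff := P.coeff_eq_zero_of_isBigO (hP.mono nhdsWithin_le_nhds) (Nat.lt_succ_self j)
  have hsum : ∑ m ∈ Finset.range j, (Polynomial.C (iteratedDeriv m G 0 / m.factorial) *
      Polynomial.X ^ (i * m)).coeff j = 0 := by
    refine Finset.sum_eq_zero fun m _ => ?_
    rw [Polynomial.coeff_C_mul, Polynomial.coeff_X_pow, if_neg, mul_zero]
    exact fun h => hij ⟨m, h⟩
  rw [Polynomial.coeff_sub, Polynomial.finsetSum_coeff, hsum,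
    Polynomial.coeff_C_mul, Polynomial.coeff_X_pow_self, mul_one, sub_zero] at hcoeff
  exact pow_ne_zero j he hcoeff

/-! ### Normal form of a frontal -/

lemma eventually_eq_of_hasDerivAt {f g f' : ℝ → ℝ} {p : ℝ}
    (hf : ∀ᶠ t in 𝓝 p, HasDerivAt f (f' t) t) (hg : ∀ᶠ t in 𝓝 p, HasDerivAt g (f' t) t)
    (h : f p = g p) : f =ᶠ[𝓝 p] g := by
  obtain ⟨r, hr, hball⟩ := Metric.eventually_nhds_iff_ball.1 (hf.and hg)
  filter_upwards [Metric.ball_mem_nhds p hr] with t ht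
  have := (convex_ball p r).is_const_of_fderivWithin_eq_zero (𝕜 := ℝ) (f := fun t => f t - g t)
    (fun t ht => ((hball t ht).1.fun_sub (hball t ht).2).differentiableAt.differentiableWithinAt)
    (fun t ht => by
      rw [fderivWithin_of_isOpen Metric.isOpen_ball ht]
      have h0 := ((hball t ht).1.fun_sub (hball t ht).2)
      rw [sub_self] at h0
      rw [h0.hasFDerivAt.fderiv]
      ext
      simp)
    ht (Metric.mem_ball_self hr)
  simp only [h, sub_self] at this
  linarith

/-- Normal form of a frontal `γ' = b (-sin (θ + u), cos (θ + u))` with `b = tⁿ b₁`, `u = tᵐ u₁`. -/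
lemma exists_frontal_normal_form {γ : ℝ → Plane} {p θ : ℝ} {n m : ℕ} {b₁ u₁ : ℝ → ℝ}
    (hm : m ≠ 0) (hb₁ : ContDiff ℝ ∞ b₁) (hu₁ : ContDiff ℝ ∞ u₁) (hb0 : b₁ 0 ≠ 0)
    (hγ : ∀ᶠ t in 𝓝 p, HasDerivAt γ (((t - p) ^ n * b₁ (t - p)) •
      (!₂[-Real.sin (θ + (t - p) ^ m * u₁ (t - p)),
        Real.cos (θ + (t - p) ^ m * u₁ (t - p))] : Plane)) t) :
    ∃ k : ℝ → ℝ, ContDiff ℝ ∞ k ∧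
      AEquivalentAt γ p (monomialCurve (n + 1) (n + m + 1) k) 0 ∧
      k 0 = -(b₁ 0 * u₁ 0) / (n + m + 1) ∧
      (2 ≤ m → deriv k 0 = -(deriv b₁ 0 * u₁ 0 + b₁ 0 * deriv u₁ 0) / (n + m + 2) +
        u₁ 0 * deriv b₁ 0 / (n + 2)) := by
  obtain ⟨S, hS, hsin⟩ := exists_eq_add_mul Real.contDiff_sin
  simp only [Real.sin_zero, zero_add] at hsin
  have hS0 : S 0 = 1 := by
    have h1 : HasDerivAt Real.sin (S 0) 0 := by
      rw [show Real.sin = fun s => s * S s from funext hsin]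
      simpa using (hasDerivAt_id' (0 : ℝ)).fun_mul (hS.hasDerivAt_infty 0)
    simpa using h1.unique (Real.hasDerivAt_sin 0)
  have hu : ContDiff ℝ ∞ fun t => t ^ m * u₁ t := (contDiff_id.pow m).mul hu₁
  -- These are b cos u and -b sin u with the factors tⁿ and tⁿ⁺ᵐ removed; S is sin x / x.
  set g₁ : ℝ → ℝ := fun t => b₁ t * Real.cos (t ^ m * u₁ t) with hg₁_def
  set g₂ : ℝ → ℝ := fun t => -(b₁ t * u₁ t) * S (t ^ m * u₁ t) with hg₂_def
  have hg₁ : ContDiff ℝ ∞ g₁ := hb₁.mul (Real.contDiff_cos.comp hu)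
  have hg₂ : ContDiff ℝ ∞ g₂ := (hb₁.mul hu₁).neg.mul (hS.comp hu)
  have hg₁0 : g₁ 0 = b₁ 0 := by simp [hg₁_def, hm]
  have hg₂0 : g₂ 0 = -(b₁ 0 * u₁ 0) := by simp [hg₂_def, hm, hS0]
  set a : ℝ := b₁ 0 / (n + 1) with ha_def
  have hn1 : (n : ℝ) + 1 ≠ 0 := by positivity
  have ha : a ≠ 0 := div_ne_zero hb0 hn1
  have hM₁ := contDiff_moment n hg₁
  have hM₂ := contDiff_moment (n + m) hg₂
  have hM₁0 : moment n g₁ 0 = a := by rw [moment_zero, hg₁0]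
  -- X and Y are the coordinates along the tangent direction (-sin θ, cos θ) and the normal (cos θ,
  -- sin θ), centred at γ(p).
  set X : Plane → ℝ := fun x =>
    (-Real.sin θ * (x 0 - γ p 0) + Real.cos θ * (x 1 - γ p 1)) with hX
  set Y : Plane → ℝ := fun x =>
    (Real.cos θ * (x 0 - γ p 0) + Real.sin θ * (x 1 - γ p 1)) with hY
  have hcoord : ∀ i : Fin 2, ∀ᶠ t in 𝓝 p, HasDerivAt (fun t => γ t i)
      (((t - p) ^ n * b₁ (t - p)) * (!₂[-Real.sin (θ + (t - p) ^ m * u₁ (t - p)),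
        Real.cos (θ + (t - p) ^ m * u₁ (t - p))] : Plane) i) t := by
    intro i
    filter_upwards [hγ] with t ht
    exact (hasFDerivAt_coord i _).comp_hasDerivAt t ht
  have hshift : ∀ (l : ℕ) {g : ℝ → ℝ}, ContDiff ℝ ∞ g → ∀ t,
      HasDerivAt (fun t => (t - p) ^ (l + 1) * moment l g (t - p)) ((t - p) ^ l * g (t - p)) t :=
    fun l g hg t => (hasDerivAt_pow_mul_moment l hg (t - p)).comp_sub_const t p
  have hXγ : (fun t => X (γ t)) =ᶠ[𝓝 p] fun t => (t - p) ^ (n + 1) * moment n g₁ (t - p) := by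
    refine eventually_eq_of_hasDerivAt ?_ (Filter.Eventually.of_forall fun t => hshift n hg₁ t)
      (by simp [hX])
    filter_upwards [hcoord 0, hcoord 1] with t h0 h1
    refine (((h0.sub_const _).const_mul (-Real.sin θ)).fun_add
      ((h1.sub_const _).const_mul (Real.cos θ))).congr_deriv ?_
    simp only [hg₁_def, Matrix.cons_val_zero, Matrix.cons_val_one, Matrix.cons_val_fin_one]
    rw [Real.sin_add, Real.cos_add]
    linear_combination (t - p) ^ n * b₁ (t - p) * Real.cos ((t - p) ^ m * u₁ (t - p)) *
      Real.sin_sq_add_cos_sq θ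
  have hYγ : (fun t => Y (γ t)) =ᶠ[𝓝 p]
      fun t => (t - p) ^ (n + m + 1) * moment (n + m) g₂ (t - p) := by
    refine eventually_eq_of_hasDerivAt ?_
      (Filter.Eventually.of_forall fun t => hshift (n + m) hg₂ t) (by simp [hY])
    filter_upwards [hcoord 0, hcoord 1] with t h0 h1
    refine (((h0.sub_const _).const_mul (Real.cos θ)).fun_add
      ((h1.sub_const _).const_mul (Real.sin θ))).congr_deriv ?_
    simp only [hg₂_def, Matrix.cons_val_zero, Matrix.cons_val_one, Matrix.cons_val_fin_one]
    have := hsin ((t - p) ^ m * u₁ (t - p))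
    rw [Real.sin_add, Real.cos_add, pow_add]
    linear_combination -(t - p) ^ n * b₁ (t - p) * this - (t - p) ^ n * b₁ (t - p) *
      Real.sin ((t - p) ^ m * u₁ (t - p)) * Real.sin_sq_add_cos_sq θ
  -- With this root, X / a is the (n+1)-st power of t B(t), which becomes the new parameter.
  obtain ⟨B, hB, hB0, hBA⟩ := exists_root (A := fun t => moment n g₁ t / a) (hM₁.div_const a)
    (by rw [hM₁0, div_self ha]) (Nat.succ_ne_zero n)
  obtain ⟨σ, v, hσ, hv, hσv, hinv, hσ'⟩ := exists_reparametrization hB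
    (by rw [hB0]; exact one_ne_zero)
  have hσ0 : σ 0 = 0 := by rw [hσv, zero_mul]
  have hv0 : v 0 = 1 := by simpa [hσ0, hB0] using hinv.self_of_nhds
  have hσt : Filter.Tendsto σ (𝓝 0) (𝓝 0) := by
    simpa [hσ0] using hσ.continuous.tendsto 0
  have hpσt : Filter.Tendsto (fun s => p + σ s) (𝓝 0) (𝓝 p) := by
    simpa using hσt.const_add p
  refine ⟨fun s => v s ^ (n + m + 1) * moment (n + m) g₂ (σ s),
    (hv.pow _).mul (hM₂.comp hσ), ?_, ?_, ?_⟩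
  · refine aequivalentAt_of_eventuallyEq (Φ := fun x => !₂[a⁻¹ * X x, Y x])
      (σ := fun s => p + σ s)
      (a := a⁻¹ • ((-Real.sin θ) • EuclideanSpace.proj 0 + Real.cos θ • EuclideanSpace.proj 1))
      (b := Real.cos θ • EuclideanSpace.proj 0 + Real.sin θ • EuclideanSpace.proj 1)
      ?_ ?_ ?_ ?_ (contDiff_const.add hσ) (by simp [hσ0]) ?_ ?_
    · rw [contDiff_euclidean]
      intro i
      fin_cases i
      · exact contDiff_const.mul ((contDiff_const.mul ((contDiff_coord 0).sub contDiff_const)).add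
          (contDiff_const.mul ((contDiff_coord 1).sub contDiff_const)))
      · exact (contDiff_const.mul ((contDiff_coord 0).sub contDiff_const)).add
          (contDiff_const.mul ((contDiff_coord 1).sub contDiff_const))
    · exact ((((hasFDerivAt_coord 0 _).sub_const _).const_mul _).add
        (((hasFDerivAt_coord 1 _).sub_const _).const_mul _)).const_mul _
    · exact (((hasFDerivAt_coord 0 _).sub_const _).const_mul _).add
        (((hasFDerivAt_coord 1 _).sub_const _).const_mul _)
    · intro x hx hx'
      have h0 : a⁻¹ * (-Real.sin θ * x 0 + Real.cos θ * x 1) = 0 := hx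
      have h1 : Real.cos θ * x 0 + Real.sin θ * x 1 = 0 := hx'
      have h0' := (mul_eq_zero.1 h0).resolve_left (inv_ne_zero ha)
      have hs := Real.sin_sq_add_cos_sq θ
      ext i
      fin_cases i
      · change x 0 = 0
        linear_combination -x 0 * hs + Real.cos θ * h1 - Real.sin θ * h0'
      · change x 1 = 0
        linear_combination -x 1 * hs + Real.sin θ * h1 + Real.cos θ * h0'
    · simpa using hσ'
    · filter_upwards [hpσt.eventually hXγ, hpσt.eventually hYγ, hinv, hσt.eventually hBA]
        with s hs₁ hs₂ hs₃ hs₄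
      rw [hs₁, hs₂, add_sub_cancel_left]
      ext i
      fin_cases i
      · simp only [monomialCurve, Fin.zero_eta, Matrix.cons_val_zero]
        have hcube : s ^ (n + 1) = σ s ^ (n + 1) * B (σ s) ^ (n + 1) := by
          rw [← mul_pow, hσv, mul_assoc, ← hσv, hs₃, mul_one]
        rw [hcube, hs₄]
        ring
      · simp only [monomialCurve, Fin.mk_one, Matrix.cons_val_one, Matrix.cons_val_fin_one]
        rw [show σ s ^ (n + m + 1) = s ^ (n + m + 1) * v s ^ (n + m + 1) by rw [hσv, mul_pow],
          mul_assoc]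
  · simp only [hv0, hσ0, moment_zero, hg₂0]
    push_cast
    ring
  · intro hm2
    have hdB : (n + 1) * deriv B 0 = deriv g₁ 0 / (n + 2) / a := by
      have h1 : HasDerivAt (fun t => B t ^ (n + 1)) _ 0 := (hB.hasDerivAt_infty 0).pow (n + 1)
      have h2 := ((hM₁.hasDerivAt_infty 0).div_const a).congr_of_eventuallyEq hBA
      have h3 := h1.unique h2
      rw [deriv_moment_zero n hg₁] at h3
      simpa [hB0] using h3
    have hdσ : HasDerivAt σ 1 0 := by
      rw [show σ = fun s => s * v s from funext hσv]
      simpa [hv0] using (hasDerivAt_id' (0 : ℝ)).fun_mul (hv.hasDerivAt_infty 0)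
    have hcompσ : ∀ {f : ℝ → ℝ}, ContDiff ℝ ∞ f →
        HasDerivAt (fun s => f (σ s)) (deriv f 0) 0 := by
      intro f hf
      have h1 := hf.hasDerivAt_infty (σ 0)
      have h2 := h1.comp (0 : ℝ) hdσ
      rw [hσ0, mul_one] at h2
      exact h2
    have hdv : deriv v 0 = -deriv B 0 := by
      have h1 := (hv.hasDerivAt_infty 0).fun_mul (hcompσ hB)
      have h2 := h1.unique ((hasDerivAt_const (0 : ℝ) (1 : ℝ)).congr_of_eventuallyEq hinv)
      simp only [hσ0, hB0, hv0] at h2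
      linarith
    -- This is where m ≥ 2 enters: tᵐ u₁ has derivative 0 at the origin, so the factors cos and S do
    -- not contribute to first order.
    have hdu : HasDerivAt (fun t => t ^ m * u₁ t) 0 0 := by
      refine ((hasDerivAt_pow m (0 : ℝ)).fun_mul (hu₁.hasDerivAt_infty 0)).congr_deriv ?_
      simp [show m - 1 ≠ 0 by omega, hm]
    have hcompu : ∀ {f : ℝ → ℝ}, ContDiff ℝ ∞ f →
        HasDerivAt (fun t => f (t ^ m * u₁ t)) 0 0 := by
      intro f hf
      have h2 := (hf.hasDerivAt_infty _).comp (0 : ℝ) hdu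
      rw [mul_zero] at h2
      exact h2
    have hdg₁ : deriv g₁ 0 = deriv b₁ 0 := by
      rw [((hb₁.hasDerivAt_infty 0).fun_mul (hcompu Real.contDiff_cos)).deriv]
      simp [hm]
    have hdg₂ : deriv g₂ 0 = -(deriv b₁ 0 * u₁ 0 + b₁ 0 * deriv u₁ 0) := by
      rw [((((hb₁.hasDerivAt_infty 0).fun_mul (hu₁.hasDerivAt_infty 0)).fun_neg).fun_mul
        (hcompu hS)).deriv]
      simp [hm, hS0]
    have hk : HasDerivAt (fun s => v s ^ (n + m + 1) * moment (n + m) g₂ (σ s)) _ 0 :=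
      ((hv.hasDerivAt_infty 0).fun_pow (n + m + 1)).fun_mul (hcompσ hM₂)
    rw [hk.deriv, hdv, deriv_moment_zero _ hg₂, hσ0, moment_zero, hdg₂, hg₂0, hv0]
    rw [hdg₁] at hdB
    have hdB' : deriv B 0 = deriv b₁ 0 / (n + 2) / b₁ 0 := by
      have : (n : ℝ) + 2 ≠ 0 := by positivity
      rw [ha_def] at hdB
      field_simp at hdB ⊢
      linear_combination hdB
    rw [hdB']
    have h2 : (n : ℝ) + 2 ≠ 0 := by positivity
    have h3 : (n : ℝ) + m + 1 ≠ 0 := by positivity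
    have h4 : (n : ℝ) + m + 2 ≠ 0 := by positivity
    push_cast
    simp only [one_pow]
    field_simp
    ring

/-! ### Comparison of orders and recognition of cusps -/

/-- The shear removing the leading even term of `t ↦ (t², t⁴ k(t))`. -/
lemma exists_monomialCurve_two_four_equiv {k : ℝ → ℝ} (hk : ContDiff ℝ ∞ k) :
    ∃ r : ℝ → ℝ, ContDiff ℝ ∞ r ∧ r 0 = deriv k 0 ∧
      AEquivalentAt (monomialCurve 2 4 k) 0 (monomialCurve 2 5 r) 0 := by
  refine ⟨_, contDiff_moment 0 hk.deriv_infty, by simp [moment_zero], ?_⟩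
  refine aequivalentAt_of_shear (c := 1) (F := fun x y => y - k 0 * x ^ 2)
    (monomialCurve_zero two_ne_zero (by simp) _) ?_ one_ne_zero ?_ fun t => ?_
  · exact (contDiff_coord 1).sub (contDiff_const.mul ((contDiff_coord 0).pow 2))
  · simpa using hasDerivAt_id' (0 : ℝ)
  · simp only [monomialCurve]
    congr 2
    have := eq_add_mul_moment hk t
    simp
    rw [this]
    ring

lemma isCuspAt_iff {i j : ℕ} {γ : ℝ → Plane} {p : ℝ} :
    IsCuspAt j i γ p ↔ AEquivalentAt γ p (monomialCurve i j fun _ => 1) 0 := by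
  have : (fun t : ℝ => (!₂[t ^ i, t ^ j] : Plane)) = monomialCurve i j fun _ => 1 := by
    funext t
    simp [monomialCurve]
  rw [IsCuspAt, this]

lemma monomialCurve_eq_of_le {i j l : ℕ} (h : l ≤ j) (k : ℝ → ℝ) :
    monomialCurve i j k = monomialCurve i l fun t => t ^ (j - l) * k t := by
  funext t
  simp only [monomialCurve, ← mul_assoc, ← pow_add, Nat.add_sub_cancel' h]

lemma monomialCurve_isBigO {i j l : ℕ} (hl : l ≠ 0) (hi : l ≤ i) (hj : l ≤ j) {k : ℝ → ℝ}
    (hk : ContDiff ℝ ∞ k) :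
    (fun t => monomialCurve i j k t - monomialCurve i j k 0) =O[𝓝 0]
      fun t : ℝ => (t - 0) ^ l := by
  rw [monomialCurve_zero (by omega) (by omega)]
  have h : (fun t => monomialCurve i j k t - 0) = fun t =>
      t ^ i • (EuclideanSpace.single 0 1 : Plane) +
        t ^ j • (k t • (EuclideanSpace.single 1 1 : Plane)) := by
    funext t
    ext m
    fin_cases m <;> simp [monomialCurve]
  rw [h]
  simp only [sub_zero]
  have h1 : (fun t : ℝ => t ^ i • (EuclideanSpace.single 0 1 : Plane)) =O[𝓝 0]
      fun t : ℝ => t ^ l • (1 : ℝ) :=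
    (isBigO_pow_of_le hi).smul (Asymptotics.isBigO_const_const _ one_ne_zero _)
  have h2 : (fun t : ℝ => t ^ j • (k t • (EuclideanSpace.single 1 1 : Plane))) =O[𝓝 0]
      fun t : ℝ => t ^ l • (1 : ℝ) :=
    (isBigO_pow_of_le hj).smul
      (((hk.continuous.smul continuous_const).tendsto 0).isBigO_one ℝ)
  simpa using h1.add h2

lemma multiplicity_le {γ : ℝ → Plane} {p : ℝ} (hγ : ContinuousAt γ p) {i j i' j' : ℕ}
    {k k' : ℝ → ℝ} (hk : ContDiff ℝ ∞ k) (hij : i ≤ j) (hi' : i' ≠ 0)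
    (h : AEquivalentAt γ p (monomialCurve i j k) 0)
    (h' : AEquivalentAt γ p (monomialCurve i' j' k') 0) : i ≤ i' := by
  by_contra! hlt
  exact not_aequivalentAt_of_isBigO hi'
    (monomialCurve_isBigO (Nat.succ_ne_zero i') (by omega) (by omega) hk)
    ((h.symm hγ).trans h')

/-- Besides rejecting curves that are too degenerate, this separates model cusps of equal
multiplicity: equivalence to the one with larger exponent excludes the smaller. -/
lemma not_aequivalentAt_of_lt {γ : ℝ → Plane} {p : ℝ} (hγ : ContinuousAt γ p) {i j l : ℕ}
    (hi : 2 ≤ i) (hij : ¬ i ∣ j) (hl : j < l) {r : ℝ → ℝ} (hr : ContDiff ℝ ∞ r)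
    (h : AEquivalentAt γ p (monomialCurve i l r) 0) :
    ¬ AEquivalentAt γ p (monomialCurve i j fun _ => 1) 0 := by
  intro h'
  rw [monomialCurve_eq_of_le (Nat.succ_le_of_lt hl)] at h
  exact not_aequivalentAt_monomialCurve hi hij ((contDiff_id.pow _).mul hr)
    ((h.symm hγ).trans h')

lemma exists_eq_mul_iteratedDeriv {f : ℝ → ℝ} (hf : ContDiff ℝ ∞ f) (hf0 : f 0 = 0) :
    ∃ r : ℝ → ℝ, ContDiff ℝ ∞ r ∧ (∀ t, f t = t * r t) ∧
      ∀ k, iteratedDeriv k r 0 = iteratedDeriv (k + 1) f 0 / (k + 1) := by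
  refine ⟨_, contDiff_moment 0 hf.deriv_infty, fun t => ?_, fun k => ?_⟩
  · rw [eq_add_mul_moment hf t, hf0, zero_add]
  · rw [iteratedDeriv_moment _ _ hf.deriv_infty, moment_zero, ← iteratedDeriv_succ']
    simp

lemma isBigO_sub_of_hasDerivAt {γ γ' : ℝ → Plane} {p C : ℝ} {n : ℕ}
    (hγ : ∀ᶠ t in 𝓝 p, HasDerivAt γ (γ' t) t)
    (hC : ∀ᶠ t in 𝓝 p, ‖γ' t‖ ≤ C * |t - p| ^ n) :
    (fun t => γ t - γ p) =O[𝓝 p] fun t => (t - p) ^ (n + 1) := by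
  obtain ⟨r, hr, hball⟩ := Metric.eventually_nhds_iff_ball.1 (hγ.and hC)
  refine Asymptotics.IsBigO.of_bound |C| ?_
  filter_upwards [Metric.ball_mem_nhds p hr] with t ht
  have hsub : Metric.closedBall p |t - p| ⊆ Metric.ball p r :=
    Metric.closedBall_subset_ball (by simpa [Real.dist_eq] using ht)
  have := (convex_closedBall p |t - p|).norm_image_sub_le_of_norm_hasDerivWithin_le
    (f := γ) (f' := γ') (C := |C| * |t - p| ^ n)
    (fun s hs => (hball s (hsub hs)).1.hasDerivWithinAt)
    (fun s hs => by
      refine (hball s (hsub hs)).2.trans ?_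
      rw [Metric.mem_closedBall, Real.dist_eq] at hs
      gcongr
      exact le_abs_self C)
    (Metric.mem_closedBall_self (abs_nonneg _)) (y := t) (by simp [Real.dist_eq])
  rw [norm_pow, pow_succ, ← mul_assoc]
  exact this

/-- Recognition of cusps for a frontal `γ' = b (-sin (θ + u), cos (θ + u))` with `b`, `u`
vanishing at the origin. -/
theorem frontal_cusp_criteria {γ : ℝ → Plane} {p θ : ℝ} {b u : ℝ → ℝ}
    (hb : ContDiff ℝ ∞ b) (hu : ContDiff ℝ ∞ u) (hb0 : b 0 = 0) (hu0 : u 0 = 0)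
    (hγ : ∀ᶠ t in 𝓝 p, HasDerivAt γ (b (t - p) •
      (!₂[-Real.sin (θ + u (t - p)), Real.cos (θ + u (t - p))] : Plane)) t) :
    (IsCuspAt 3 2 γ p ↔ deriv b 0 * deriv u 0 ≠ 0) ∧
    (IsCuspAt 5 2 γ p ↔
      deriv b 0 ≠ 0 ∧ deriv u 0 = 0 ∧
        iteratedDeriv 2 b 0 * iteratedDeriv 2 u 0 - deriv b 0 * iteratedDeriv 3 u 0 ≠ 0) ∧
    (IsCuspAt 4 3 γ p ↔ deriv b 0 = 0 ∧ iteratedDeriv 2 b 0 * deriv u 0 ≠ 0) ∧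
    (IsCuspAt 5 3 γ p ↔
      (deriv b 0 = 0 ∧ deriv u 0 = 0) ∧ iteratedDeriv 2 b 0 * iteratedDeriv 2 u 0 ≠ 0) := by
  have hc : ContinuousAt γ p := hγ.self_of_nhds.continuousAt
  have hone : ContDiff ℝ ∞ fun _ : ℝ => (1 : ℝ) := contDiff_const
  simp only [isCuspAt_iff]
  have h23_32 : ∀ {l l' : ℕ} {r r' : ℝ → ℝ}, ContDiff ℝ ∞ r' → 3 ≤ l' →
      AEquivalentAt γ p (monomialCurve 2 l r) 0 → ¬ AEquivalentAt γ p (monomialCurve 3 l' r') 0 :=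
    fun hr' hl h h' => by
      have := multiplicity_le hc hr' hl two_ne_zero h' h
      omega
  obtain ⟨b₁, hb₁, hbb₁, hdb₁⟩ := exists_eq_mul_iteratedDeriv hb hb0
  obtain ⟨u₁, hu₁, huu₁, hdu₁⟩ := exists_eq_mul_iteratedDeriv hu hu0
  have hb₁0 : b₁ 0 = deriv b 0 := by simpa using hdb₁ 0
  have hu₁0 : u₁ 0 = deriv u 0 := by simpa using hdu₁ 0
  have hb₁1 : deriv b₁ 0 = iteratedDeriv 2 b 0 / 2 := by
    have := hdb₁ 1
    rw [iteratedDeriv_one] at this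
    rw [this]
    norm_num
  by_cases hβ1 : deriv b 0 = 0
  · rw [hβ1] at hb₁0
    obtain ⟨b₂, hb₂, hbb₂, hdb₂⟩ := exists_eq_mul_iteratedDeriv hb₁ hb₁0
    have hb₂0 : b₂ 0 = iteratedDeriv 2 b 0 / 2 := by
      have := hdb₂ 0
      simp only [iteratedDeriv_zero, zero_add, iteratedDeriv_one, Nat.cast_zero, div_one] at this
      rw [this, hb₁1]
    by_cases hβ2 : iteratedDeriv 2 b 0 = 0
    -- Now b is divisible by t³, so γ - γ(p) is of order 4 and γ has neither multiplicity 2 nor 3.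
    · rw [hβ2, zero_div] at hb₂0
      obtain ⟨b₃, hb₃, hbb₃, -⟩ := exists_eq_mul_iteratedDeriv hb₂ hb₂0
      obtain ⟨C, hC⟩ := ((hb₃.continuous.tendsto 0).isBigO_one ℝ).bound
      have hO : (fun t => γ t - γ p) =O[𝓝 p] fun t => (t - p) ^ (3 + 1) := by
        refine isBigO_sub_of_hasDerivAt (C := C) hγ ?_
        have ht : Filter.Tendsto (fun t => t - p) (𝓝 p) (𝓝 0) :=
          Continuous.tendsto' (by fun_prop) _ _ (sub_self p)
        filter_upwards [ht.eventually hC] with t ht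
        rw [norm_one, mul_one] at ht
        have hunit : ‖(!₂[-Real.sin (θ + u (t - p)), Real.cos (θ + u (t - p))] : Plane)‖ = 1 := by
          simp [EuclideanSpace.norm_eq, Fin.sum_univ_two]
        rw [norm_smul, hunit, mul_one, hbb₁, hbb₂, hbb₃, norm_mul, norm_mul, norm_mul,
          Real.norm_eq_abs (t - p)]
        calc |t - p| * (|t - p| * (|t - p| * ‖b₃ (t - p)‖))
            = ‖b₃ (t - p)‖ * |t - p| ^ 3 := by ring
          _ ≤ C * |t - p| ^ 3 := by gcongr
      have hO' : (fun t => γ t - γ p) =O[𝓝 p] fun t => (t - p) ^ (2 + 1) := by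
        refine hO.trans ?_
        have ht : Filter.Tendsto (fun t => t - p) (𝓝 p) (𝓝 0) :=
          Continuous.tendsto' (by fun_prop) _ _ (sub_self p)
        exact (isBigO_pow_of_le (by norm_num : 3 ≤ 4)).comp_tendsto ht
      have n3 := fun j => not_aequivalentAt_of_isBigO (j := j) (k := fun _ => 1) three_ne_zero hO
      have n2 := fun j => not_aequivalentAt_of_isBigO (j := j) (k := fun _ => 1) two_ne_zero hO'
      simp [n2, n3, hβ1, hβ2]
    · have hb₂0' : b₂ 0 ≠ 0 := by rw [hb₂0]; exact div_ne_zero hβ2 two_ne_zero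
      by_cases hφ1 : deriv u 0 = 0
      · rw [hφ1] at hu₁0
        obtain ⟨u₂, hu₂, huu₂, hdu₂⟩ := exists_eq_mul_iteratedDeriv hu₁ hu₁0
        have hu₂0 : u₂ 0 = iteratedDeriv 2 u 0 / 2 := by
          have h1 := hdu₂ 0
          have h2 := hdu₁ 1
          norm_num at h1 h2
          rw [h1, h2]
        obtain ⟨k, hk, hγk, hk0, -⟩ := exists_frontal_normal_form (γ := γ) (p := p) (θ := θ)
          (n := 2) (m := 2) two_ne_zero hb₂ hu₂ hb₂0' (by
            filter_upwards [hγ] with t ht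
            rw [hbb₁, hbb₂, huu₁, huu₂, ← mul_assoc, ← mul_assoc, ← sq] at ht
            exact ht)
        norm_num at hγk hk0
        by_cases hφ2 : iteratedDeriv 2 u 0 = 0
        -- The germ is then (t³, t⁶ k'), and neither 4 nor 5 is a multiple of 3.
        · have hk00 : k 0 = 0 := by rw [hk0, hu₂0, hφ2]; ring
          obtain ⟨k', hk', hkk', -⟩ := exists_eq_mul_iteratedDeriv hk hk00
          have hγk' : AEquivalentAt γ p (monomialCurve 3 6 k') 0 := by
            rw [monomialCurve_eq_of_le (show 5 ≤ 6 by norm_num)]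
            simpa [← hkk'] using hγk
          have n4 := not_aequivalentAt_of_lt hc (j := 4) (by norm_num) (by norm_num)
            (by norm_num) hk' hγk'
          have n5 := not_aequivalentAt_of_lt hc (j := 5) (by norm_num) (by norm_num)
            (by norm_num) hk' hγk'
          have n2 : ∀ j, ¬ AEquivalentAt γ p (monomialCurve 2 j fun _ => 1) 0 := fun j h =>
            h23_32 hk' (by norm_num) h hγk'
          simp [n2, n4, n5, hβ1, hφ1, hφ2]
        · have hk00 : k 0 ≠ 0 := by
            rw [hk0, hu₂0]
            exact div_ne_zero (neg_ne_zero.2 (mul_ne_zero hb₂0' (div_ne_zero hφ2 two_ne_zero)))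
              (by norm_num)
          have y5 := hγk.trans (monomialCurve_three_five_equiv hk hk00)
          have n4 := not_aequivalentAt_of_lt hc (j := 4) (by norm_num) (by norm_num)
            (by norm_num) hone y5
          have n2 : ∀ j, ¬ AEquivalentAt γ p (monomialCurve 2 j fun _ => 1) 0 := fun j h =>
            h23_32 hone (by norm_num) h y5
          simp [n2, n4, y5, hβ1, hφ1, hφ2, hβ2]
      · obtain ⟨k, hk, hγk, hk0, -⟩ := exists_frontal_normal_form (γ := γ) (p := p) (θ := θ)
          (n := 2) (m := 1) one_ne_zero hb₂ hu₁ hb₂0' (by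
            filter_upwards [hγ] with t ht
            rw [hbb₁, hbb₂, huu₁, ← mul_assoc, ← sq] at ht
            simpa using ht)
        norm_num at hγk hk0
        have hk00 : k 0 ≠ 0 := by
          rw [hk0, hu₁0]
          exact div_ne_zero (neg_ne_zero.2 (mul_ne_zero hb₂0' hφ1)) (by norm_num)
        have y4 := hγk.trans (monomialCurve_three_four_equiv hk hk00)
        have n5 : ¬ AEquivalentAt γ p (monomialCurve 3 5 fun _ => 1) 0 := fun h =>
          not_aequivalentAt_of_lt hc (j := 4) (by norm_num) (by norm_num) (by norm_num) hone h y4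
        have n2 : ∀ j, ¬ AEquivalentAt γ p (monomialCurve 2 j fun _ => 1) 0 := fun j h =>
          h23_32 hone (by norm_num) h y4
        simp [n2, n5, y4, hβ1, hφ1, hβ2]
  · have hb₁0' : b₁ 0 ≠ 0 := by rwa [hb₁0]
    by_cases hφ1 : deriv u 0 = 0
    · rw [hφ1] at hu₁0
      obtain ⟨u₂, hu₂, huu₂, hdu₂⟩ := exists_eq_mul_iteratedDeriv hu₁ hu₁0
      have hu₂0 : u₂ 0 = iteratedDeriv 2 u 0 / 2 := by
        have h1 := hdu₂ 0
        have h2 := hdu₁ 1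
        norm_num at h1 h2
        rw [h1, h2]
      have hu₂1 : deriv u₂ 0 = iteratedDeriv 3 u 0 / 6 := by
        have h1 := hdu₂ 1
        have h2 := hdu₁ 2
        norm_num at h1 h2
        rw [h1, h2]
        ring
      obtain ⟨k, hk, hγk, -, hk1⟩ := exists_frontal_normal_form (γ := γ) (p := p) (θ := θ)
        (n := 1) (m := 2) two_ne_zero hb₁ hu₂ hb₁0' (by
          filter_upwards [hγ] with t ht
          rw [hbb₁, huu₁, huu₂, ← mul_assoc, ← sq] at ht
          simpa using ht)
      have hk1 := hk1 le_rfl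
      norm_num at hγk hk1
      -- The coefficient of b'' u'' is -1/20 + 1/12 = 1/30, and that of b' u''' is -1/30.
      have hD : deriv k 0 = (iteratedDeriv 2 b 0 * iteratedDeriv 2 u 0 -
          deriv b 0 * iteratedDeriv 3 u 0) / 30 := by
        rw [hk1, hu₂0, hu₂1, hb₁0, hb₁1]
        ring
      obtain ⟨r, hr, hr0, hkr⟩ := exists_monomialCurve_two_four_equiv hk
      have hγr := hγk.trans hkr
      have n3 := not_aequivalentAt_of_lt hc (j := 3) (by norm_num) (by norm_num)
        (by norm_num) hr hγr
      have n3' := fun (j : ℕ) (hj : 3 ≤ j) => h23_32 hone hj hγr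
      have n34 := n3' 4 (by norm_num)
      have n35 := n3' 5 (by norm_num)
      by_cases hD0 : iteratedDeriv 2 b 0 * iteratedDeriv 2 u 0 -
          deriv b 0 * iteratedDeriv 3 u 0 = 0
      · rw [hD0, zero_div] at hD
        obtain ⟨r', hr', hrr', -⟩ := exists_eq_mul_iteratedDeriv hr (hr0.trans hD)
        have hγr' : AEquivalentAt γ p (monomialCurve 2 6 r') 0 := by
          rw [monomialCurve_eq_of_le (show 5 ≤ 6 by norm_num)]
          simpa [← hrr'] using hγr
        have n5 := not_aequivalentAt_of_lt hc (j := 5) (by norm_num) (by norm_num)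
          (by norm_num) hr' hγr'
        simp [n3, n34, n35, n5, hβ1, hφ1, hD0]
      · have hr00 : r 0 ≠ 0 := by
          rw [hr0, hD]
          exact div_ne_zero hD0 (by norm_num)
        have y5 := hγr.trans (monomialCurve_two_equiv 2 hr hr00)
        norm_num at y5
        simp [n3, n34, n35, y5, hβ1, hφ1, hD0]
    · obtain ⟨k, hk, hγk, hk0, -⟩ := exists_frontal_normal_form (γ := γ) (p := p) (θ := θ)
        (n := 1) (m := 1) one_ne_zero hb₁ hu₁ hb₁0' (by
          filter_upwards [hγ] with t ht
          rw [hbb₁, huu₁] at ht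
          simpa using ht)
      norm_num at hγk hk0
      have hk00 : k 0 ≠ 0 := by
        rw [hk0, hu₁0]
        exact div_ne_zero (neg_ne_zero.2 (mul_ne_zero hb₁0' hφ1)) (by norm_num)
      have y3 := hγk.trans (monomialCurve_two_equiv 1 hk hk00)
      norm_num at y3
      have n5 : ¬ AEquivalentAt γ p (monomialCurve 2 5 fun _ => 1) 0 := fun h =>
        not_aequivalentAt_of_lt hc (j := 3) (by norm_num) (by norm_num) (by norm_num) hone h y3
      have n34 := h23_32 (l' := 4) hone (by norm_num) y3
      have n35 := h23_32 (l' := 5) hone (by norm_num) y3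
      simp [n34, n35, n5, y3, hβ1, hφ1]

/-! ### From Legendre curves to frontals -/

theorem mainTheorem1 (I : Set ℝ) (hI : I.OrdConnected) (t₀ : ℝ) (ht₀ : t₀ ∈ interior I)
    (γ ν : ℝ → Plane) (φ β : ℝ → ℝ)
    (hLegendre : IsLegendreCurve γ ν I)
    (hφ : ContDiffOn ℝ ∞ φ I)
    (hν : ∀ t ∈ I, ν t = !₂[Real.cos (φ t), Real.sin (φ t)])
    (hβ : ∀ t ∈ I, β t = (legendreCurvature γ ν I t).2)
    (hβ₀ : β t₀ = 0) :
    (IsCuspAt 3 2 γ t₀ ↔ deriv β t₀ * deriv φ t₀ ≠ 0) ∧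
    (IsCuspAt 5 2 γ t₀ ↔
      deriv β t₀ ≠ 0 ∧ deriv φ t₀ = 0 ∧
        iteratedDeriv 2 β t₀ * iteratedDeriv 2 φ t₀
          - deriv β t₀ * iteratedDeriv 3 φ t₀ ≠ 0) ∧
    (IsCuspAt 4 3 γ t₀ ↔
      deriv β t₀ = 0 ∧ iteratedDeriv 2 β t₀ * deriv φ t₀ ≠ 0) ∧
    (IsCuspAt 5 3 γ t₀ ↔
      (deriv β t₀ = 0 ∧ deriv φ t₀ = 0) ∧
        iteratedDeriv 2 β t₀ * iteratedDeriv 2 φ t₀ ≠ 0) := by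
  have hev : ∀ᶠ t in 𝓝 t₀, t ∈ interior I := isOpen_interior.eventually_mem ht₀
  have hdw : ∀ t ∈ interior I, derivWithin γ I t = deriv γ t := fun t ht =>
    derivWithin_of_mem_nhds (mem_interior_iff_mem_nhds.1 ht)
  have hβ' : ∀ t ∈ interior I, β t =
      -(deriv γ t 0) * Real.sin (φ t) + deriv γ t 1 * Real.cos (φ t) := by
    intro t ht
    rw [hβ t (interior_subset ht), legendreCurvature, hdw t ht, hν t (interior_subset ht)]
    simp [rotJ, PiLp.inner_apply, Fin.sum_univ_two]
    ring
  have htan : ∀ t ∈ interior I,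
      deriv γ t 0 * Real.cos (φ t) + deriv γ t 1 * Real.sin (φ t) = 0 := by
    intro t ht
    have h := hLegendre.tangency t (interior_subset ht)
    rw [hdw t ht, hν t (interior_subset ht)] at h
    simp [PiLp.inner_apply, Fin.sum_univ_two] at h
    linarith
  have hγc := hLegendre.smooth_curve.mono interior_subset
  have hγd : ContDiffOn ℝ ∞ (deriv γ) (interior I) :=
    ((contDiffOn_infty_iff_deriv_of_isOpen isOpen_interior).1 hγc).2
  have hφc := hφ.mono interior_subset
  have hβs : ContDiffOn ℝ ∞ β (interior I) := by
    refine ContDiffOn.congr ?_ hβ'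
    exact (((contDiff_coord 0).comp_contDiffOn hγd).neg.mul
      (Real.contDiff_sin.comp_contDiffOn hφc)).add
      (((contDiff_coord 1).comp_contDiffOn hγd).mul (Real.contDiff_cos.comp_contDiffOn hφc))
  -- γ' is expanded in the orthonormal frame (μ, ν): its component along ν vanishes by tangency.
  have hγ' : ∀ t ∈ interior I,
      HasDerivAt γ (β t • (!₂[-Real.sin (φ t), Real.cos (φ t)] : Plane)) t := by
    intro t ht
    have hd := ((hγc.contDiffAt (isOpen_interior.mem_nhds ht)).differentiableAt
      (by simp)).hasDerivAt
    refine hd.congr_deriv ?_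
    have h1 := hβ' t ht
    have h2 := htan t ht
    have h3 := Real.sin_sq_add_cos_sq (φ t)
    ext i
    fin_cases i
    · simp
      linear_combination -deriv γ t 0 * h3 + Real.cos (φ t) * h2 + Real.sin (φ t) * h1
    · simp
      linear_combination -deriv γ t 1 * h3 + Real.sin (φ t) * h2 - Real.cos (φ t) * h1
  -- The criteria are stated for globally smooth data, so β and φ are replaced by global extensions
  -- of their germs at t₀, which have the same derivatives there.
  obtain ⟨b, hb, hbe⟩ := exists_contDiff_eventuallyEq (f := β) (p := t₀) (by
    filter_upwards [hev] with t ht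
    exact hβs.contDiffAt (isOpen_interior.mem_nhds ht))
  obtain ⟨u, hu, hue⟩ := exists_contDiff_eventuallyEq (f := φ) (p := t₀) (by
    filter_upwards [hev] with t ht
    exact hφc.contDiffAt (isOpen_interior.mem_nhds ht))
  have hib : ∀ n, iteratedDeriv n (fun t => b (t₀ + t)) 0 = iteratedDeriv n β t₀ := by
    intro n
    rw [iteratedDeriv_comp_const_add]
    simp only [add_zero]
    exact hbe.iteratedDeriv_eq n
  have hiu : ∀ n, n ≠ 0 →
      iteratedDeriv n (fun t => u (t₀ + t) - u t₀) 0 = iteratedDeriv n φ t₀ := by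
    intro n hn
    obtain ⟨m, rfl⟩ := Nat.exists_eq_succ_of_ne_zero hn
    have h1 : deriv (fun t => u (t₀ + t) - u t₀) = deriv fun t => u (t₀ + t) := by
      funext t
      simp
    rw [iteratedDeriv_succ', h1, ← iteratedDeriv_succ', iteratedDeriv_comp_const_add]
    simp only [add_zero]
    exact hue.iteratedDeriv_eq _
  have key := frontal_cusp_criteria (γ := γ) (p := t₀) (θ := u t₀) (b := fun t => b (t₀ + t))
    (u := fun t => u (t₀ + t) - u t₀) (hb.comp (contDiff_const.add contDiff_id))
    ((hu.comp (contDiff_const.add contDiff_id)).sub contDiff_const)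
    (by simp [hbe.eq_of_nhds, hβ₀]) (by simp) (by
      filter_upwards [hev, hbe, hue] with t ht hbt hut
      simpa [hbt, hut] using hγ' t ht)
  have hb1 := hib 1
  have hu1 := hiu 1 one_ne_zero
  rw [iteratedDeriv_one, iteratedDeriv_one] at hb1 hu1
  rwa [hb1, hu1, hib 2, hiu 2 two_ne_zero, hiu 3 three_ne_zero] at key
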